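/- Let $\mathbb N=\{1,2,\ldots\}$, let $k\ge 2$ be a fixed integer, and let $f:\mathbb N\to\mathbb C$ be a multiplicative function for which there are real constants $C_1,C_2$ such that $|f(p)-p|\le C_1\,p^{1/2}$ for every prime $p$ and $|f(p^\nu)|\le C_2\,p^{\nu}$ for every prime $p$ and every integer $\nu\ge 2$ (that is, $f$ belongs to the class $\mathcal A_1$). Then for every $\varepsilon>0$ and all real $x\ge 1$, $$\sum_{\substack{n_1,\ldots,n_k\in\mathbb N\\ n_1^2+\cdots+n_k^2\le x}} f([n_1,\ldots,n_k])=\frac{C_{f,k}}{2^k\,k!}\,x^k+O\!\left(x^{k-1/4+\varepsilon}\right),$$ where $[n_1,\ldots,n_k]$ is the least common multiple, the implied constant depends only on $k$, $f$ and $\varepsilon$, and $$C_{f,k}=\prod_p\left(1-\frac1p\right)^{k}\sum_{\nu_1,\ldots,\nu_k=0}^{\infty}\frac{f\!\left(p^{\max(\nu_1,\ldots,\nu_k)}\right)}{p^{2(\nu_1+\cdots+\nu_k)}},$$ the product being over all primes $p$; the series converges absolutely for every prime $p$, and the product converges unconditionally. -/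

import Mathlib

open scoped BigOperators ArithmeticFunction

noncomputable section

/-- The class `𝒜_r`: multiplicative functions `f : {1, 2, …} → ℂ` for which there are real
constants `C₁`, `C₂` with `|f(p) - p^r| ≤ C₁ p^(r - 1/2)` for all primes `p` and
`|f(p^ν)| ≤ C₂ p^(ν r)` for all primes `p` and all `ν ≥ 2`. -/
def ClassA (r : ℝ) (f : ArithmeticFunction ℂ) : Prop :=
  f.IsMultiplicative ∧
    (∃ C₁ : ℝ, ∀ p : ℕ, p.Prime →
      ‖f p - (((p : ℝ) ^ r : ℝ) : ℂ)‖ ≤ C₁ * (p : ℝ) ^ (r - 1 / 2)) ∧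
    (∃ C₂ : ℝ, ∀ p ν : ℕ, p.Prime → 2 ≤ ν → ‖f (p ^ ν)‖ ≤ C₂ * (p : ℝ) ^ ((ν : ℝ) * r))

/-- The `k`-tuples of positive integers with `n_1² + ⋯ + n_k² ≤ x`
(they all lie in the box `1 ≤ n_i ≤ x`, see `mem_ballPoints`). -/
def ballPoints (k : ℕ) (x : ℝ) : Finset (Fin k → ℕ) :=
  (Fintype.piFinset fun _ : Fin k => Finset.Icc 1 ⌊x⌋₊).filter
    fun n => ∑ i, (n i : ℝ) ^ 2 ≤ x

theorem mem_ballPoints (k : ℕ) (x : ℝ) (n : Fin k → ℕ) :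
    n ∈ ballPoints k x ↔ (∀ i, 1 ≤ n i) ∧ ∑ i, (n i : ℝ) ^ 2 ≤ x := by
  simp only [ballPoints, Finset.mem_filter, Fintype.mem_piFinset, Finset.mem_Icc]
  refine ⟨fun h => ⟨fun i => (h.1 i).1, h.2⟩, fun h => ⟨fun i => ⟨h.1 i, ?_⟩, h.2⟩⟩
  apply Nat.le_floor
  have h1 : (1 : ℝ) ≤ n i := by exact_mod_cast h.1 i
  have h2 : (n i : ℝ) ^ 2 ≤ ∑ j, (n j : ℝ) ^ 2 :=
    Finset.single_le_sum (f := fun j => (n j : ℝ) ^ 2) (fun j _ => sq_nonneg _)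
      (Finset.mem_univ i)
  nlinarith [h.2]

/-- `∑ f([n_1, …, n_k])` over positive integers with `n_1² + ⋯ + n_k² ≤ x`. -/
def lcmBallSum (f : ArithmeticFunction ℂ) (k : ℕ) (x : ℝ) : ℂ :=
  ∑ n ∈ ballPoints k x, f (Finset.univ.lcm n)

/-- `f(p^(max(ν_1, …, ν_k))) / p^(2(ν_1 + ⋯ + ν_k))`. -/
def lcmLocalTerm (f : ArithmeticFunction ℂ) (k p : ℕ) (ν : Fin k → ℕ) : ℂ :=
  f (p ^ Finset.univ.sup ν) / (p : ℂ) ^ (2 * ∑ i, ν i)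

/-- The factor at `p` of the Euler product. -/
def lcmLocalFactor (f : ArithmeticFunction ℂ) (k p : ℕ) : ℂ :=
  (1 - 1 / (p : ℂ)) ^ k * ∑' ν : Fin k → ℕ, lcmLocalTerm f k p ν

/-- The constant `C_{f,k}`, a product over all primes. -/
def lcmConst (f : ArithmeticFunction ℂ) (k : ℕ) : ℂ :=
  ∏' p : Nat.Primes, lcmLocalFactor f k p

end

open scoped BigOperators ArithmeticFunction

noncomputable section

/-! Möbius inversion in each variable gives f([n_1,…,n_k]) = ∑_{d_i e_i = n_i} g(d) e_1⋯e_k, where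
the kernel g = `lcmKernel f k` is multiplicative in k variables. The sum over the ball becomes ∑_d
g(d) E(d, x), with E = `ellipsoidSum` carrying all dependence on x.

Put D = d_1⋯d_k. The main term of E is x^k / (2^k k! D²), with error O(x^(k-1/2)/D) from the
boundary (`exists_abs_ellipsoidSum_sub_le`) and trivially O(x^k/D²) (`ellipsoidSum_le`).
Interpolation gives O(x^(k-θ/2) D^(θ-2)) for 0 ≤ θ ≤ 1, uniformly in d, so the sum over d needs no
truncation.

It remains to see that ∑ |g(d)| D^(-σ) converges for σ > 3/2 (`summable_prodFiberSum_norm`). When D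
is a prime p, the kernel is exactly f(p) - p, hence O(p^(1/2)); the tuples with D = p^N contribute
O(N^(2k) p^N). Both the primes and the squares of primes then put the abscissa at 3/2. With σ = 2 -
θ this allows every θ < 1/2, which is the exponent k - 1/4 + ε.

The constant is ∑_d g(d)/D². Collecting the d with D = m turns it into an ordinary Dirichlet series
at 2 with an Euler product; convolving with μ(n)n in k coordinates contributes the factor (1 -
1/p)^k at each prime. -/

/-! ### Riemann sums of t (y² - t²)^k -/

theorem pow_sub_pow_le_mul_pow {A B : ℝ} (hB : 0 ≤ B) (hBA : B ≤ A) (k : ℕ) :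
    A ^ k - B ^ k ≤ k * A ^ (k - 1) * (A - B) := by
  have hA : 0 ≤ A := hB.trans hBA
  induction k with
  | zero => simp
  | succ k ih =>
    have h1 : B ^ k ≤ A ^ k := pow_le_pow_left₀ hB hBA k
    have h2 : B * (A ^ k - B ^ k) ≤ A * (k * A ^ (k - 1) * (A - B)) :=
      mul_le_mul hBA ih (sub_nonneg.2 h1) hA
    have h3 : A * (k * A ^ (k - 1) * (A - B)) = k * A ^ k * (A - B) := by
      cases k with
      | zero => simp
      | succ k => simp only [Nat.add_sub_cancel]; ring
    rw [h3] at h2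
    simp only [Nat.add_sub_cancel]
    push_cast
    linear_combination h2

theorem mul_pow_le_pow_sub_pow {A B : ℝ} (hB : 0 ≤ B) (hBA : B ≤ A) (k : ℕ) :
    (k + 1) * B ^ k * (A - B) ≤ A ^ (k + 1) - B ^ (k + 1) := by
  have hA : 0 ≤ A := hB.trans hBA
  induction k with
  | zero => simp
  | succ k ih =>
    have h1 : B ^ (k + 1) ≤ A ^ (k + 1) := pow_le_pow_left₀ hB hBA _
    have h2 := mul_le_mul_of_nonneg_left ih hB
    have h3 := mul_nonneg (sub_nonneg.2 hBA) (sub_nonneg.2 h1)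
    push_cast
    linear_combination h2 + h3

/-- The Riemann sum of `t (y² - t²)^k` at a single integer, compared with the integral. -/
theorem abs_mul_pow_sub_integral_le {y e : ℝ} (he : 1 ≤ e) (hey : e ≤ y) (k : ℕ) :
    |e * (y ^ 2 - e ^ 2) ^ k -
      ((y ^ 2 - (e - 1) ^ 2) ^ (k + 1) - (y ^ 2 - e ^ 2) ^ (k + 1)) / (2 * (k + 1))|
      ≤ (2 * k + 1) * y ^ (2 * k) := by
  set A := y ^ 2 - (e - 1) ^ 2 with hA
  set B := y ^ 2 - e ^ 2 with hB
  have hB0 : 0 ≤ B := by nlinarith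
  have hAB : A - B = 2 * e - 1 := by rw [hA, hB]; ring
  have hBA : B ≤ A := by linarith
  have hA0 : 0 ≤ A := hB0.trans hBA
  have hAy : A ≤ y ^ 2 := by rw [hA]; nlinarith [sq_nonneg (e - 1)]
  have hk : (0 : ℝ) < 2 * (k + 1) := by positivity
  have hBk : B ^ k ≤ y ^ (2 * k) := by
    rw [pow_mul]; exact pow_le_pow_left₀ hB0 (hBA.trans hAy) k
  have hy0 : 0 ≤ y ^ (2 * k) := by rw [pow_mul]; positivity
  have h1 := pow_sub_pow_le_mul_pow hB0 hBA (k + 1)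
  have h2 := mul_pow_le_pow_sub_pow hB0 hBA k
  have h3 := pow_sub_pow_le_mul_pow hB0 hBA k
  rw [hAB] at h1 h2 h3
  simp only [Nat.add_sub_cancel] at h1
  push_cast at h1
  -- Since A - B = 2e - 1, the integral lies between (2e-1)B^k/2 and (2e-1)A^k/2. This bounds the
  -- cost, with weight e, of replacing A^k by B^k; for k = 0 the factor k cancels the truncated
  -- exponent.
  have h4 : (k : ℝ) * A ^ (k - 1) * (2 * e - 1) * e ≤ 2 * k * y ^ (2 * k) := by
    cases k with
    | zero => simp
    | succ k =>
      simp only [Nat.add_sub_cancel]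
      have h5 : A ^ k ≤ (y ^ 2) ^ k := pow_le_pow_left₀ hA0 hAy k
      have h6 : (2 * e - 1) * e ≤ 2 * y ^ 2 := by nlinarith
      have h7 : A ^ k * ((2 * e - 1) * e) ≤ (y ^ 2) ^ k * (2 * y ^ 2) :=
        mul_le_mul h5 h6 (by nlinarith) (by positivity)
      have h8 := mul_le_mul_of_nonneg_left h7 (by positivity : (0 : ℝ) ≤ ((k + 1 : ℕ) : ℝ))
      calc _ = ((k + 1 : ℕ) : ℝ) * (A ^ k * ((2 * e - 1) * e)) := by ring
        _ ≤ _ := h8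
        _ = _ := by ring
  have hAk : 0 ≤ A ^ k := by positivity
  rw [abs_le]
  constructor
  · have : (A ^ (k + 1) - B ^ (k + 1)) / (2 * (k + 1)) ≤ A ^ k * (2 * e - 1) / 2 := by
      rw [div_le_iff₀ hk]; linear_combination h1
    have h9 := mul_le_mul_of_nonneg_right h3 (by linarith : (0 : ℝ) ≤ e)
    nlinarith
  · have : B ^ k * (2 * e - 1) / 2 ≤ (A ^ (k + 1) - B ^ (k + 1)) / (2 * (k + 1)) := by
      rw [le_div_iff₀ hk]; linear_combination h2
    have : 0 ≤ k * y ^ (2 * k) := by positivity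
    nlinarith [pow_nonneg hB0 k]

/-- The integrals over unit intervals telescope, and at most y intervals each cost (2k+1) y^(2k).
The unfinished interval beyond N = ⌊y⌋ costs a power of R = y² - N², which is at most 2y as well as
y². -/
theorem sum_mul_pow_sub_sq {y : ℝ} (hy : 0 ≤ y) (k : ℕ) :
    |∑ e ∈ Finset.Icc 1 ⌊y⌋₊, (e : ℝ) * (y ^ 2 - (e : ℝ) ^ 2) ^ k -
      y ^ (2 * k + 2) / (2 * (k + 1))| ≤ (2 * k + 2) * y ^ (2 * k + 1) := by
  set N := ⌊y⌋₊ with hN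
  have hNy : (N : ℝ) ≤ y := Nat.floor_le hy
  have hyN : y < N + 1 := Nat.lt_floor_add_one y
  have key : ∀ M : ℕ, M ≤ N →
      |∑ e ∈ Finset.Icc 1 M, (e : ℝ) * (y ^ 2 - (e : ℝ) ^ 2) ^ k -
        ((y ^ 2) ^ (k + 1) - (y ^ 2 - (M : ℝ) ^ 2) ^ (k + 1)) / (2 * (k + 1))|
        ≤ M * ((2 * k + 1) * y ^ (2 * k)) := by
    intro M
    induction M with
    | zero => intro _; simp
    | succ M ih =>
      intro hM
      have h1 := ih (by omega)
      have hMy : ((M + 1 : ℕ) : ℝ) ≤ y := le_trans (by exact_mod_cast hM) hNy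
      have h2 := abs_mul_pow_sub_integral_le (e := ((M + 1 : ℕ) : ℝ)) (by simp) hMy k
      rw [Finset.sum_Icc_succ_top (by omega)]
      have h3 := (abs_add_le _ _).trans (add_le_add h1 h2)
      have h4 : (((M + 1 : ℕ) : ℝ) - 1) = M := by push_cast; ring
      rw [h4] at h3
      refine le_trans (le_of_eq ?_) (h3.trans (le_of_eq ?_))
      · congr 1; ring
      · push_cast; ring
  have h1 := key N le_rfl
  set R := y ^ 2 - (N : ℝ) ^ 2 with hR
  have hR0 : 0 ≤ R := by have : (0 : ℝ) ≤ N := by positivity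
                         nlinarith
  have hR1 : R ≤ 2 * y := by nlinarith
  have hR2 : R ≤ y ^ 2 := by rw [hR]; nlinarith [sq_nonneg (N : ℝ)]
  have hk : (0 : ℝ) < 2 * (k + 1) := by positivity
  have h2 : |R ^ (k + 1) / (2 * (k + 1))| ≤ y ^ (2 * k + 1) := by
    rw [abs_of_nonneg (by positivity), div_le_iff₀ hk]
    have h3 : R ^ k ≤ y ^ (2 * k) := by rw [pow_mul]; exact pow_le_pow_left₀ hR0 hR2 k
    have h4 : R ^ k * R ≤ y ^ (2 * k) * (2 * y) := mul_le_mul h3 hR1 hR0 (by positivity)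
    have h5 : 0 ≤ k * y ^ (2 * k + 1) := by positivity
    rw [pow_succ] at h5 ⊢
    rw [pow_succ]
    nlinarith
  have h3 : N * ((2 * k + 1) * y ^ (2 * k)) ≤ (2 * k + 1) * y ^ (2 * k + 1) := by
    have := mul_le_mul_of_nonneg_right hNy
      (by positivity : (0 : ℝ) ≤ (2 * k + 1) * y ^ (2 * k))
    rw [pow_succ]; nlinarith
  have h4 := (abs_sub _ _).trans (add_le_add h1 h2)
  refine le_trans (le_of_eq ?_) (h4.trans ?_)
  · congr 1; rw [← pow_mul]; ring
  · linarith

theorem sum_Icc_floor_le {y : ℝ} (hy : 0 ≤ y) :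
    ∑ e ∈ Finset.Icc 1 ⌊y⌋₊, (e : ℝ) ≤ y ^ 2 := by
  have hNy : (⌊y⌋₊ : ℝ) ≤ y := Nat.floor_le hy
  calc ∑ e ∈ Finset.Icc 1 ⌊y⌋₊, (e : ℝ) ≤ ∑ e ∈ Finset.Icc 1 ⌊y⌋₊, y := by
        refine Finset.sum_le_sum fun e he => ?_
        have : (e : ℝ) ≤ ⌊y⌋₊ := by exact_mod_cast (Finset.mem_Icc.1 he).2
        linarith
    _ = ⌊y⌋₊ * y := by simp
    _ ≤ y ^ 2 := by nlinarith

/-! ### Weighted lattice sums over ellipsoids, uniformly in the axes -/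

/-- The `k`-tuples of positive integers with `∑ (d_i e_i)² ≤ x`. -/
def ellipsoidPoints (k : ℕ) (d : Fin k → ℕ) (x : ℝ) : Finset (Fin k → ℕ) :=
  (Fintype.piFinset fun _ : Fin k => Finset.Icc 1 ⌊x⌋₊).filter
    fun e => ∑ i, ((d i : ℝ) * e i) ^ 2 ≤ x

theorem mem_ellipsoidPoints {k : ℕ} {d : Fin k → ℕ} (hd : ∀ i, 1 ≤ d i) {x : ℝ}
    {e : Fin k → ℕ} :
    e ∈ ellipsoidPoints k d x ↔ (∀ i, 1 ≤ e i) ∧ ∑ i, ((d i : ℝ) * e i) ^ 2 ≤ x := by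
  simp only [ellipsoidPoints, Finset.mem_filter, Fintype.mem_piFinset, Finset.mem_Icc]
  refine ⟨fun h => ⟨fun i => (h.1 i).1, h.2⟩, fun h => ⟨fun i => ⟨h.1 i, ?_⟩, h.2⟩⟩
  apply Nat.le_floor
  have h1 : (1 : ℝ) ≤ e i := by exact_mod_cast h.1 i
  have h3 : (1 : ℝ) ≤ d i := by exact_mod_cast hd i
  have h2 : ((d i : ℝ) * e i) ^ 2 ≤ ∑ j, ((d j : ℝ) * e j) ^ 2 :=
    Finset.single_le_sum (f := fun j => ((d j : ℝ) * e j) ^ 2) (fun j _ => sq_nonneg _)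
      (Finset.mem_univ i)
  nlinarith [h.2, mul_le_mul h3 h1 zero_le_one (by linarith)]

/-- `∑ e_1 ⋯ e_k` over the positive integers with `∑ (d_i e_i)² ≤ x`. -/
def ellipsoidSum (k : ℕ) (d : Fin k → ℕ) (x : ℝ) : ℝ :=
  ∑ e ∈ ellipsoidPoints k d x, ∏ i, (e i : ℝ)

theorem ellipsoidSum_zero (d : Fin 0 → ℕ) {x : ℝ} (hx : 0 ≤ x) : ellipsoidSum 0 d x = 1 := by
  have : ellipsoidPoints 0 d x = {Fin.elim0} := by
    ext e
    rw [mem_ellipsoidPoints (fun i => i.elim0)]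
    simp [hx, Subsingleton.elim e Fin.elim0]
  simp [ellipsoidSum, this]

/-- Slicing along the first coordinate drives both inductions on the dimension. Writing the radius
as s² makes the range of the slice s / d_0. -/
theorem ellipsoidSum_succ {k : ℕ} {d : Fin (k + 1) → ℕ} (hd : ∀ i, 1 ≤ d i) {s : ℝ}
    (hs : 0 ≤ s) :
    ellipsoidSum (k + 1) d (s ^ 2) = ∑ a ∈ Finset.Icc 1 ⌊s / d 0⌋₊,
      (a : ℝ) * ellipsoidSum k (Fin.tail d) (s ^ 2 - ((d 0 : ℝ) * a) ^ 2) := by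
  have hd' : ∀ i, 1 ≤ Fin.tail d i := fun i => hd _
  have hd0 : (0 : ℝ) < d 0 := by exact_mod_cast hd 0
  simp only [ellipsoidSum, Finset.mul_sum]
  rw [Finset.sum_sigma']
  refine Finset.sum_nbij' (fun e => ⟨e 0, Fin.tail e⟩) (fun z => Fin.cons z.1 z.2) ?_ ?_ ?_ ?_ ?_
  · intro e he
    rw [mem_ellipsoidPoints hd, Fin.sum_univ_succ] at he
    rw [Finset.mem_sigma, mem_ellipsoidPoints hd']
    refine ⟨Finset.mem_Icc.2 ⟨he.1 0, Nat.le_floor ?_⟩, fun i => he.1 _, ?_⟩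
    · rw [le_div_iff₀ hd0, mul_comm]
      refine le_of_sq_le_sq ?_ hs
      have : 0 ≤ ∑ i : Fin k, ((d i.succ : ℝ) * e i.succ) ^ 2 :=
        Finset.sum_nonneg fun i _ => sq_nonneg _
      linarith [he.2]
    · simp only [Fin.tail]
      linarith [he.2]
  · rintro ⟨a, e⟩ he
    rw [Finset.mem_sigma, mem_ellipsoidPoints hd'] at he
    rw [mem_ellipsoidPoints hd, Fin.sum_univ_succ]
    simp only [Fin.tail] at he
    refine ⟨fun i => ?_, ?_⟩
    · refine Fin.cases ?_ (fun i => ?_) i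
      · exact (Finset.mem_Icc.1 he.1).1
      · simpa using he.2.1 i
    · simp only [Fin.cons_zero, Fin.cons_succ]
      linarith [he.2.2]
  · intro e _; exact Fin.cons_self_tail e
  · intro z _; simp
  · intro e _
    rw [Fin.prod_univ_succ]; rfl

theorem ellipsoidSum_nonneg (k : ℕ) (d : Fin k → ℕ) (x : ℝ) : 0 ≤ ellipsoidSum k d x :=
  Finset.sum_nonneg fun _ _ => Finset.prod_nonneg fun _ _ => Nat.cast_nonneg _

theorem sub_sq_nonneg_of_mem {d s : ℝ} (hd : 0 < d) (hs : 0 ≤ s) {a : ℕ}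
    (ha : a ∈ Finset.Icc 1 ⌊s / d⌋₊) : 0 ≤ s ^ 2 - (d * a) ^ 2 := by
  have h1 : (a : ℝ) ≤ s / d :=
    (Nat.le_floor_iff (by positivity)).1 (Finset.mem_Icc.1 ha).2
  rw [le_div_iff₀ hd] at h1
  have h2 : 0 ≤ (a : ℝ) := by positivity
  have : 0 ≤ d * a := by positivity
  nlinarith

theorem ellipsoidSum_le (k : ℕ) : ∀ (d : Fin k → ℕ), (∀ i, 1 ≤ d i) → ∀ x : ℝ, 0 ≤ x →
    ellipsoidSum k d x ≤ x ^ k / ((∏ i, d i : ℕ) : ℝ) ^ 2 := by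
  induction k with
  | zero => intro d _ x hx; simp [ellipsoidSum_zero d hx]
  | succ k ih =>
    intro d hd x hx
    obtain ⟨s, hs, rfl⟩ : ∃ s : ℝ, 0 ≤ s ∧ x = s ^ 2 :=
      ⟨√x, Real.sqrt_nonneg x, (Real.sq_sqrt hx).symm⟩
    have hd0 : (0 : ℝ) < d 0 := by exact_mod_cast hd 0
    have hD : (0 : ℝ) < ((∏ i, Fin.tail d i : ℕ) : ℝ) := by
      exact_mod_cast Finset.prod_pos fun i _ => hd _
    rw [ellipsoidSum_succ hd hs]
    have h1 : ∀ a ∈ Finset.Icc 1 ⌊s / d 0⌋₊,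
        (a : ℝ) * ellipsoidSum k (Fin.tail d) (s ^ 2 - ((d 0 : ℝ) * a) ^ 2) ≤
          a * ((s ^ 2) ^ k / ((∏ i, Fin.tail d i : ℕ) : ℝ) ^ 2) := by
      intro a ha
      have h2 := sub_sq_nonneg_of_mem hd0 hs ha
      refine mul_le_mul_of_nonneg_left ((ih _ (fun i => hd _) _ h2).trans ?_) (by positivity)
      exact div_le_div_of_nonneg_right (pow_le_pow_left₀ h2
        (by nlinarith [sq_nonneg ((d 0 : ℝ) * a)]) k) (by positivity)
    refine (Finset.sum_le_sum h1).trans ?_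
    rw [← Finset.sum_mul]
    refine (mul_le_mul_of_nonneg_right (sum_Icc_floor_le (by positivity))
      (by positivity)).trans (le_of_eq ?_)
    rw [Fin.prod_univ_succ, pow_succ]
    simp only [Fin.tail] at hD ⊢
    push_cast at hD ⊢
    field_simp
    ring

/-- Induction by slices: the previous error is summed with weight a over a ≤ y = s / d_0, costing a
factor y², and the previous main term is a Riemann sum. The clause `k = 0 → C = 0` is needed because
2k - 1 truncates to 0 there: a nonzero constant would give s² where the first step requires s. All s
≥ 0 are allowed since slices may be arbitrarily small. -/
theorem exists_abs_ellipsoidSum_sub_le (k : ℕ) : ∃ C : ℝ, 0 ≤ C ∧ (k = 0 → C = 0) ∧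
    ∀ (d : Fin k → ℕ), (∀ i, 1 ≤ d i) → ∀ s : ℝ, 0 ≤ s →
      |ellipsoidSum k d (s ^ 2) -
        (s ^ 2) ^ k / (2 ^ k * (k.factorial : ℝ) * ((∏ i, d i : ℕ) : ℝ) ^ 2)|
        ≤ C * s ^ (2 * k - 1) / ((∏ i, d i : ℕ) : ℝ) := by
  induction k with
  | zero =>
    refine ⟨0, le_rfl, fun _ => rfl, fun d _ s hs => ?_⟩
    simp [ellipsoidSum_zero d (sq_nonneg s)]
  | succ k ih =>
    obtain ⟨C, hC, hC0, h⟩ := ih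
    refine ⟨C + (2 * k + 2), by positivity, by simp, fun d hd s hs => ?_⟩
    have hd1 : (1 : ℝ) ≤ d 0 := by exact_mod_cast hd 0
    have hd0 : (0 : ℝ) < d 0 := by linarith
    have hP : ((∏ i, d i : ℕ) : ℝ) = d 0 * ((∏ i, Fin.tail d i : ℕ) : ℝ) := by
      rw [Fin.prod_univ_succ]; simp [Fin.tail]
    set D : ℝ := ((∏ i, Fin.tail d i : ℕ) : ℝ) with hDdef
    have hD1 : (1 : ℝ) ≤ D := by
      rw [hDdef]; exact_mod_cast Nat.one_le_iff_ne_zero.2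
        (Finset.prod_ne_zero_iff.2 fun i _ => Nat.one_le_iff_ne_zero.1 (hd _))
    have hD0 : 0 < D := by linarith
    set y := s / d 0 with hy
    have hy0 : 0 ≤ y := by positivity
    have hsy : s = d 0 * y := by rw [hy]; field_simp
    set W : ℝ := 2 ^ k * (k.factorial : ℝ) * D ^ 2 with hW
    have hfac : (1 : ℝ) ≤ 2 ^ k * (k.factorial : ℝ) := by
      have h1 : (1 : ℝ) ≤ 2 ^ k := one_le_pow₀ (by norm_num)
      have h2 : (1 : ℝ) ≤ k.factorial := by exact_mod_cast k.factorial_pos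
      nlinarith
    have hWD : D ≤ W := by nlinarith [sq_nonneg D]
    have hW0 : 0 < W := by linarith
    rw [ellipsoidSum_succ hd hs, hP]
    have h1 : |∑ a ∈ Finset.Icc 1 ⌊y⌋₊,
        (a : ℝ) * ellipsoidSum k (Fin.tail d) (s ^ 2 - ((d 0 : ℝ) * a) ^ 2) -
        ∑ a ∈ Finset.Icc 1 ⌊y⌋₊, (a : ℝ) * ((s ^ 2 - ((d 0 : ℝ) * a) ^ 2) ^ k / W)|
        ≤ C * s ^ (2 * (k + 1) - 1) / (d 0 * D) := by
      rw [← Finset.sum_sub_distrib]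
      have h2 : ∀ a ∈ Finset.Icc 1 ⌊y⌋₊,
          |(a : ℝ) * ellipsoidSum k (Fin.tail d) (s ^ 2 - ((d 0 : ℝ) * a) ^ 2) -
            (a : ℝ) * ((s ^ 2 - ((d 0 : ℝ) * a) ^ 2) ^ k / W)| ≤
          a * (C * s ^ (2 * k - 1) / D) := by
        intro a ha
        have h3 := sub_sq_nonneg_of_mem hd0 hs ha
        rw [← mul_sub, abs_mul, abs_of_nonneg (by positivity : (0 : ℝ) ≤ a)]
        refine mul_le_mul_of_nonneg_left ?_ (by positivity)
        have h4 := h (Fin.tail d) (fun i => hd _) _ (Real.sqrt_nonneg (s ^ 2 - (d 0 * a) ^ 2))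
        rw [Real.sq_sqrt h3] at h4
        refine h4.trans ?_
        gcongr
        refine Real.sqrt_le_iff.2 ⟨hs, ?_⟩
        nlinarith [sq_nonneg ((d 0 : ℝ) * a)]
      refine (Finset.abs_sum_le_sum_abs _ _).trans ((Finset.sum_le_sum h2).trans ?_)
      rw [← Finset.sum_mul]
      refine (mul_le_mul_of_nonneg_right (sum_Icc_floor_le hy0) (by positivity)).trans ?_
      rcases Nat.eq_zero_or_pos k with rfl | hk
      · simp [hC0 rfl]
      · have h5 : 2 * (k + 1) - 1 = (2 * k - 1) + 2 := by omega
        rw [h5, hy, div_pow, div_mul_div_comm, div_le_div_iff₀ (by positivity) (by positivity)]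
        have h6 : 0 ≤ C * s ^ (2 * k - 1 + 2) * D * d 0 := by positivity
        rw [pow_add] at h6 ⊢
        nlinarith
    -- Rescaling by s = d_0 y reduces this to `sum_mul_pow_sub_sq`; its error is divided by W, and D
    -- ≤ W suffices.
    have h2 : |∑ a ∈ Finset.Icc 1 ⌊y⌋₊, (a : ℝ) * ((s ^ 2 - ((d 0 : ℝ) * a) ^ 2) ^ k / W) -
        (s ^ 2) ^ (k + 1) / (2 ^ (k + 1) * ((k + 1).factorial : ℝ) * (d 0 * D) ^ 2)|
        ≤ (2 * k + 2) * s ^ (2 * (k + 1) - 1) / (d 0 * D) := by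
      have h3 := sum_mul_pow_sub_sq hy0 k
      have h4 : ∑ a ∈ Finset.Icc 1 ⌊y⌋₊, (a : ℝ) * ((s ^ 2 - ((d 0 : ℝ) * a) ^ 2) ^ k / W) =
          (d 0 : ℝ) ^ (2 * k) / W *
            ∑ a ∈ Finset.Icc 1 ⌊y⌋₊, (a : ℝ) * (y ^ 2 - (a : ℝ) ^ 2) ^ k := by
        rw [Finset.mul_sum]
        refine Finset.sum_congr rfl fun a _ => ?_
        rw [hsy, mul_pow, mul_pow, ← mul_sub, mul_pow, ← pow_mul]
        ring
      have h5 : (s ^ 2) ^ (k + 1) / (2 ^ (k + 1) * ((k + 1).factorial : ℝ) * (d 0 * D) ^ 2) =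
          (d 0 : ℝ) ^ (2 * k) / W * (y ^ (2 * k + 2) / (2 * (k + 1))) := by
        rw [hsy, hW, Nat.factorial_succ]
        have : (k.factorial : ℝ) ≠ 0 := by positivity
        push_cast
        field_simp
        ring
      rw [h4, h5, ← mul_sub, abs_mul, abs_of_nonneg (by positivity)]
      refine (mul_le_mul_of_nonneg_left h3 (by positivity)).trans ?_
      have h6 : 2 * (k + 1) - 1 = 2 * k + 1 := by omega
      rw [h6, hsy, div_mul_eq_mul_div, div_le_div_iff₀ hW0 (by positivity)]
      have h7 : 0 ≤ (2 * k + 2) * ((d 0 : ℝ) ^ (2 * k + 1) * y ^ (2 * k + 1)) := by positivity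
      calc _ = (2 * k + 2) * ((d 0 : ℝ) ^ (2 * k + 1) * y ^ (2 * k + 1)) * D := by ring
        _ ≤ (2 * k + 2) * ((d 0 : ℝ) ^ (2 * k + 1) * y ^ (2 * k + 1)) * W := by gcongr
        _ = _ := by rw [mul_pow]
    refine (abs_sub_le _ _ _).trans ((add_le_add h1 h2).trans (le_of_eq ?_))
    ring

/-- The error term interpolated between the trivial bound and the boundary bound. -/
theorem exists_abs_ellipsoidSum_sub_le_rpow (k : ℕ) (hk : 1 ≤ k) : ∃ C : ℝ, 0 ≤ C ∧
    ∀ (d : Fin k → ℕ), (∀ i, 1 ≤ d i) → ∀ x : ℝ, 1 ≤ x → ∀ θ : ℝ, 0 ≤ θ → θ ≤ 1 →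
      |ellipsoidSum k d x - x ^ k / (2 ^ k * (k.factorial : ℝ) * ((∏ i, d i : ℕ) : ℝ) ^ 2)|
        ≤ C * (x ^ ((k : ℝ) - θ / 2) * ((∏ i, d i : ℕ) : ℝ) ^ (θ - 2)) := by
  obtain ⟨C, hC, -, h⟩ := exists_abs_ellipsoidSum_sub_le k
  refine ⟨max C 1, le_max_of_le_left hC, fun d hd x hx θ hθ0 hθ1 => ?_⟩
  have hx0 : 0 < x := by linarith
  set D : ℝ := ((∏ i, d i : ℕ) : ℝ) with hD
  have hD0 : 0 < D := by rw [hD]; exact_mod_cast Finset.prod_pos fun i _ => hd i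
  set Δ := |ellipsoidSum k d x - x ^ k / (2 ^ k * (k.factorial : ℝ) * D ^ 2)| with hΔ
  -- Up to the constant C, t is the ratio of the boundary bound to the trivial one; the
  -- interpolation is min(1, t) ≤ t^θ.
  set t := D / √x with ht
  have hs0 : 0 < √x := Real.sqrt_pos.2 hx0
  have ht0 : 0 < t := by positivity
  have hB0 : 0 < x ^ k / D ^ 2 := by positivity
  have h1 : Δ ≤ x ^ k / D ^ 2 := by
    have h2 := ellipsoidSum_le k d hd x hx0.le
    have h3 := ellipsoidSum_nonneg k d x
    have hfac : (1 : ℝ) ≤ 2 ^ k * (k.factorial : ℝ) := by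
      have h1 : (1 : ℝ) ≤ 2 ^ k := one_le_pow₀ (by norm_num)
      have h2 : (1 : ℝ) ≤ k.factorial := by exact_mod_cast k.factorial_pos
      nlinarith
    have h4 : x ^ k / (2 ^ k * (k.factorial : ℝ) * D ^ 2) ≤ x ^ k / D ^ 2 := by
      gcongr
      nlinarith [sq_nonneg D]
    have h5 : 0 ≤ x ^ k / (2 ^ k * (k.factorial : ℝ) * D ^ 2) := by positivity
    rw [hΔ, abs_le]
    constructor <;> linarith
  have h2 : Δ ≤ C * (x ^ k / D ^ 2 * t) := by
    have h3 := h d hd _ hs0.le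
    rw [Real.sq_sqrt hx0.le] at h3
    refine h3.trans (le_of_eq ?_)
    have h4 : x ^ k = √x ^ (2 * k - 1) * √x := by
      rw [← pow_succ, Nat.sub_add_cancel (by omega), pow_mul, Real.sq_sqrt hx0.le]
    rw [h4, ht, ← hD]
    field_simp
  have h3 : Δ ≤ max C 1 * (x ^ k / D ^ 2 * t ^ θ) := by
    rcases le_total t 1 with h | h
    · have : t ≤ t ^ θ := by
        simpa using Real.rpow_le_rpow_of_exponent_ge ht0 h hθ1
      refine h2.trans ?_
      gcongr
      exact le_max_left _ _
    · have : 1 ≤ t ^ θ := Real.one_le_rpow h hθ0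
      calc Δ ≤ 1 * (x ^ k / D ^ 2 * 1) := by simpa using h1
        _ ≤ _ := by gcongr; exact le_max_right _ _
  refine h3.trans (le_of_eq ?_)
  rw [ht, Real.div_rpow hD0.le hs0.le, Real.sqrt_eq_rpow, ← Real.rpow_mul hx0.le,
    Real.rpow_sub hx0, Real.rpow_sub hD0, Real.rpow_natCast, Real.rpow_two,
    show 1 / 2 * θ = θ / 2 by ring]
  field_simp

/-! ### Dirichlet convolution and multiplicativity in k variables -/

section TupleConvolution

variable {R : Type*} [CommRing R] {k : ℕ}

/-- The pairs of `k`-tuples with coordinatewise product `d`. -/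
def tupleAntidiag (d : Fin k → ℕ) : Finset (Fin k → ℕ × ℕ) :=
  Fintype.piFinset fun i => (d i).divisorsAntidiagonal

theorem mem_tupleAntidiag {d : Fin k → ℕ} {z : Fin k → ℕ × ℕ} :
    z ∈ tupleAntidiag d ↔ ∀ i, (z i).1 * (z i).2 = d i ∧ d i ≠ 0 := by
  simp [tupleAntidiag, Fintype.mem_piFinset, Nat.mem_divisorsAntidiagonal]

/-- Dirichlet convolution of `h` with `φ ⊗ ⋯ ⊗ φ`. -/
def tupleConv (φ : ArithmeticFunction R) (h : (Fin k → ℕ) → R) (d : Fin k → ℕ) : R :=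
  ∑ z ∈ tupleAntidiag d, (∏ i, φ (z i).1) * h fun i => (z i).2

/-- Multiplicativity of a function of `k` variables. -/
structure IsTupleMultiplicative (F : (Fin k → ℕ) → R) : Prop where
  map_one : F (fun _ => 1) = 1
  map_mul : ∀ a b : Fin k → ℕ, Nat.Coprime (∏ i, a i) (∏ i, b i) →
    F (fun i => a i * b i) = F a * F b

/-- The arithmetic function `m ↦ ∑_{d_1 ⋯ d_k = m} F(d_1, …, d_k)`. -/
def prodFiberSum (F : (Fin k → ℕ) → R) : ArithmeticFunction R :=
  ⟨fun m => ∑ d ∈ Nat.finMulAntidiag k m, F d, by simp⟩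

theorem prodFiberSum_apply (F : (Fin k → ℕ) → R) (m : ℕ) :
    prodFiberSum F m = ∑ d ∈ Nat.finMulAntidiag k m, F d := rfl

theorem prod_gcd_eq_of_coprime {m n : ℕ} (hmn : m.Coprime n) {x : Fin k → ℕ}
    (hx : ∏ i, x i = m * n) : ∏ i, (x i).gcd m = m := by
  have hx' : ∀ i, (x i).gcd m * (x i).gcd n = x i := fun i => by
    rw [← Nat.Coprime.gcd_mul _ hmn]
    exact Nat.gcd_eq_left (hx ▸ Finset.dvd_prod_of_mem x (Finset.mem_univ i))
  have h1 : (∏ i, (x i).gcd m) * (∏ i, (x i).gcd n) = m * n := by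
    rw [← Finset.prod_mul_distrib, ← hx]; exact Finset.prod_congr rfl fun i _ => hx' i
  have h2 : (∏ i, (x i).gcd m).Coprime n :=
    Nat.Coprime.prod_left fun i _ => hmn.coprime_dvd_left (Nat.gcd_dvd_right _ _)
  have h3 : m.Coprime (∏ i, (x i).gcd n) :=
    Nat.Coprime.prod_right fun i _ => hmn.coprime_dvd_right (Nat.gcd_dvd_right _ _)
  exact Nat.dvd_antisymm (h2.dvd_of_dvd_mul_right (h1 ▸ Nat.dvd_mul_right _ _))
    (h3.dvd_of_dvd_mul_right (h1 ▸ Nat.dvd_mul_right _ _))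

theorem gcd_mul_eq_left {a b m n : ℕ} (hmn : m.Coprime n) (ha : a ∣ m) (hb : b ∣ n) :
    (a * b).gcd m = a := by
  have h : b.Coprime m := (hmn.coprime_dvd_right hb).symm
  rw [Nat.Coprime.gcd_mul_right_cancel _ h]
  exact Nat.gcd_eq_left ha

/-- For coprime m and n, a tuple with product mn splits uniquely into its coordinatewise gcds with m
and with n. -/
theorem IsTupleMultiplicative.prodFiberSum {F : (Fin k → ℕ) → R}
    (hF : IsTupleMultiplicative F) : (prodFiberSum F).IsMultiplicative := by
  refine ⟨?_, fun {m n} hmn => ?_⟩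
  · rw [prodFiberSum_apply, Nat.finMulAntidiag_one, Finset.sum_singleton, hF.map_one]
  · rw [prodFiberSum_apply, prodFiberSum_apply, prodFiberSum_apply, Finset.sum_mul_sum,
      ← Finset.sum_product']
    symm
    refine Finset.sum_nbij' (fun z i => z.1 i * z.2 i)
      (fun x => (fun i => (x i).gcd m, fun i => (x i).gcd n)) ?_ ?_ ?_ ?_ ?_
    · rintro ⟨u, v⟩ h
      simp only [Finset.mem_product, Nat.mem_finMulAntidiag] at h ⊢
      rw [Finset.prod_mul_distrib, h.1.1, h.2.1]
      exact ⟨rfl, mul_ne_zero h.1.2 h.2.2⟩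
    · intro x h
      simp only [Finset.mem_product, Nat.mem_finMulAntidiag] at h ⊢
      exact ⟨⟨prod_gcd_eq_of_coprime hmn h.1, left_ne_zero_of_mul h.2⟩,
        prod_gcd_eq_of_coprime hmn.symm (h.1.trans (mul_comm _ _)), right_ne_zero_of_mul h.2⟩
    · rintro ⟨u, v⟩ h
      simp only [Finset.mem_product] at h
      ext i
      · exact gcd_mul_eq_left hmn (Nat.dvd_of_mem_finMulAntidiag h.1 i)
          (Nat.dvd_of_mem_finMulAntidiag h.2 i)
      · simp only
        rw [mul_comm]
        exact gcd_mul_eq_left hmn.symm (Nat.dvd_of_mem_finMulAntidiag h.2 i)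
          (Nat.dvd_of_mem_finMulAntidiag h.1 i)
    · intro x h
      ext i
      simp only
      rw [← Nat.Coprime.gcd_mul _ hmn]
      exact Nat.gcd_eq_left (Nat.dvd_of_mem_finMulAntidiag h i)
    · rintro ⟨u, v⟩ h
      simp only [Finset.mem_product, Nat.mem_finMulAntidiag] at h
      exact (hF.map_mul u v (by rwa [h.1.1, h.2.1])).symm

theorem coprime_of_coprime_prod {a b : Fin k → ℕ}
    (h : Nat.Coprime (∏ i, a i) (∏ i, b i)) (i : Fin k) : (a i).Coprime (b i) :=
  Nat.Coprime.of_dvd (Finset.dvd_prod_of_mem a (Finset.mem_univ i))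
    (Finset.dvd_prod_of_mem b (Finset.mem_univ i)) h

theorem IsTupleMultiplicative.tupleConv {φ : ArithmeticFunction R} (hφ : φ.IsMultiplicative)
    {h : (Fin k → ℕ) → R} (hh : IsTupleMultiplicative h) :
    IsTupleMultiplicative (tupleConv φ h) := by
  refine ⟨?_, fun a b hab => ?_⟩
  · have : tupleAntidiag (fun _ : Fin k => 1) = {fun _ => (1, 1)} := by
      ext z
      simp only [mem_tupleAntidiag, Finset.mem_singleton, funext_iff, Prod.ext_iff,
        mul_eq_one]
      simp
    simp [_root_.tupleConv, this, hφ.map_one, hh.map_one]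
  · have hi := coprime_of_coprime_prod hab
    simp only [_root_.tupleConv]
    rw [Finset.sum_mul_sum, ← Finset.sum_product']
    symm
    refine Finset.sum_nbij'
      (fun z i => ((z.1 i).1 * (z.2 i).1, (z.1 i).2 * (z.2 i).2))
      (fun x => (fun i => ((x i).1.gcd (a i), (x i).2.gcd (a i)),
        fun i => ((x i).1.gcd (b i), (x i).2.gcd (b i)))) ?_ ?_ ?_ ?_ ?_
    · rintro ⟨u, v⟩ h
      simp only [Finset.mem_product, mem_tupleAntidiag] at h ⊢
      intro i
      rw [← (h.1 i).1, ← (h.2 i).1, (h.1 i).1, (h.2 i).1]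
      refine ⟨?_, mul_ne_zero (h.1 i).2 (h.2 i).2⟩
      rw [← (h.1 i).1, ← (h.2 i).1]; ring
    · intro x h
      simp only [Finset.mem_product, mem_tupleAntidiag] at h ⊢
      exact ⟨fun i => ⟨Nat.gcd_mul_gcd_of_coprime_of_mul_eq_mul (hi i) (h i).1,
          left_ne_zero_of_mul (h i).2⟩,
        fun i => ⟨Nat.gcd_mul_gcd_of_coprime_of_mul_eq_mul (hi i).symm
          ((h i).1.trans (mul_comm _ _)), right_ne_zero_of_mul (h i).2⟩⟩
    · rintro ⟨u, v⟩ h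
      simp only [Finset.mem_product, mem_tupleAntidiag] at h
      have h1 := fun i => Dvd.intro _ (h.1 i).1
      have h2 := fun i => Dvd.intro_left _ (h.1 i).1
      have h3 := fun i => Dvd.intro _ (h.2 i).1
      have h4 := fun i => Dvd.intro_left _ (h.2 i).1
      simp only [Prod.mk.injEq]
      refine ⟨funext fun i => Prod.ext ?_ ?_, funext fun i => Prod.ext ?_ ?_⟩
      · exact gcd_mul_eq_left (hi i) (h1 i) (h3 i)
      · exact gcd_mul_eq_left (hi i) (h2 i) (h4 i)
      · simp only
        rw [mul_comm]; exact gcd_mul_eq_left (hi i).symm (h3 i) (h1 i)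
      · simp only
        rw [mul_comm]; exact gcd_mul_eq_left (hi i).symm (h4 i) (h2 i)
    · intro x h
      rw [mem_tupleAntidiag] at h
      refine funext fun i => Prod.ext ?_ ?_
      · simp only
        rw [← Nat.Coprime.gcd_mul _ (hi i)]
        exact Nat.gcd_eq_left (Dvd.intro _ (h i).1)
      · simp only
        rw [← Nat.Coprime.gcd_mul _ (hi i)]
        exact Nat.gcd_eq_left (Dvd.intro_left _ (h i).1)
    · rintro ⟨u, v⟩ h
      simp only [Finset.mem_product, mem_tupleAntidiag] at h
      have h1 : ∀ i, φ ((u i).1 * (v i).1) = φ (u i).1 * φ (v i).1 := fun i =>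
        hφ.map_mul_of_coprime (Nat.Coprime.of_dvd (Dvd.intro _ (h.1 i).1)
          (Dvd.intro _ (h.2 i).1) (hi i))
      have h2 := hh.map_mul (fun i => (u i).2) (fun i => (v i).2)
        (Nat.Coprime.of_dvd
          (Finset.prod_dvd_prod_of_dvd _ _ fun i _ => Dvd.intro_left _ (h.1 i).1)
          (Finset.prod_dvd_prod_of_dvd _ _ fun i _ => Dvd.intro_left _ (h.2 i).1) hab)
      simp only [h1, h2, Finset.prod_mul_distrib]
      ring

theorem IsTupleMultiplicative.norm {F : (Fin k → ℕ) → ℂ} (hF : IsTupleMultiplicative F) :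
    IsTupleMultiplicative fun d => ‖F d‖ :=
  ⟨by simp [hF.map_one], fun a b hab => by rw [hF.map_mul a b hab, norm_mul]⟩

theorem isTupleMultiplicative_lcm {f : ArithmeticFunction R} (hf : f.IsMultiplicative) :
    IsTupleMultiplicative fun n : Fin k → ℕ => f (Finset.univ.lcm n) := by
  refine ⟨?_, fun a b hab => ?_⟩
  · have : Finset.univ.lcm (fun _ : Fin k => 1) = 1 :=
      Nat.dvd_one.1 (Finset.lcm_dvd fun _ _ => dvd_rfl)
    simp [this, hf.map_one]
  · have hdvd : ∀ a : Fin k → ℕ, Finset.univ.lcm a ∣ ∏ i, a i := fun a =>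
      Finset.lcm_dvd fun i hi => Finset.dvd_prod_of_mem a hi
    have h1 : (Finset.univ.lcm a).Coprime (Finset.univ.lcm b) :=
      Nat.Coprime.of_dvd (hdvd a) (hdvd b) hab
    rw [← hf.map_mul_of_coprime h1]
    congr 1
    refine Nat.dvd_antisymm (Finset.lcm_dvd fun i hi =>
      mul_dvd_mul (Finset.dvd_lcm hi) (Finset.dvd_lcm hi)) ?_
    exact h1.mul_dvd_of_dvd_of_dvd
      (Finset.lcm_dvd fun i hi => (Dvd.intro _ rfl).trans (Finset.dvd_lcm hi))
      (Finset.lcm_dvd fun i hi => (Dvd.intro_left _ rfl).trans (Finset.dvd_lcm hi))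

/-- Associativity; with φ * ψ = 1 it becomes Möbius inversion in every coordinate at once. -/
theorem tupleConv_tupleConv (φ ψ : ArithmeticFunction R) (h : (Fin k → ℕ) → R)
    (n : Fin k → ℕ) : tupleConv φ (tupleConv ψ h) n = tupleConv (φ * ψ) h n := by
  have h1 : ∀ z : Fin k → ℕ × ℕ, ∏ i, (φ * ψ) (z i).1 =
      ∑ y ∈ tupleAntidiag fun i => (z i).1, ∏ i, (φ (y i).1 * ψ (y i).2) := by
    intro z
    simp only [ArithmeticFunction.mul_apply, tupleAntidiag]
    exact Finset.prod_univ_sum _ _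
  simp only [tupleConv, h1, Finset.mul_sum, Finset.sum_mul]
  rw [Finset.sum_sigma', Finset.sum_sigma']
  refine Finset.sum_nbij'
    (fun z => ⟨fun i => ((z.1 i).1 * (z.2 i).1, (z.2 i).2), fun i => ((z.1 i).1, (z.2 i).1)⟩)
    (fun z => ⟨fun i => ((z.2 i).1, (z.2 i).2 * (z.1 i).2), fun i => ((z.2 i).2, (z.1 i).2)⟩)
    ?_ ?_ ?_ ?_ ?_
  · rintro ⟨z, w⟩ hz
    simp only [Finset.mem_sigma, mem_tupleAntidiag] at hz ⊢
    refine ⟨fun i => ⟨?_, (hz.1 i).2⟩, fun i => ⟨trivial, ?_⟩⟩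
    · rw [mul_assoc, (hz.2 i).1, (hz.1 i).1]
    · have h2 := hz.2 i
      have h3 := hz.1 i
      rw [← h3.1, ← h2.1] at h3
      exact fun h4 => h3.2 (by rw [← mul_assoc, h4, zero_mul])
  · rintro ⟨z, w⟩ hz
    simp only [Finset.mem_sigma, mem_tupleAntidiag] at hz ⊢
    refine ⟨fun i => ⟨?_, (hz.1 i).2⟩, fun i => ⟨trivial, ?_⟩⟩
    · rw [← mul_assoc, (hz.2 i).1, (hz.1 i).1]
    · have h2 := hz.2 i
      have h3 := hz.1 i
      rw [← h3.1, ← h2.1] at h3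
      exact fun h4 => h3.2 (by rw [mul_assoc, h4, mul_zero])
  · rintro ⟨z, w⟩ hz
    simp only [Finset.mem_sigma, mem_tupleAntidiag] at hz
    simp only [Sigma.mk.injEq, heq_eq_eq, and_true]
    exact funext fun i => Prod.ext rfl (hz.2 i).1
  · rintro ⟨z, w⟩ hz
    simp only [Finset.mem_sigma, mem_tupleAntidiag] at hz
    simp only [Sigma.mk.injEq, heq_eq_eq, and_true]
    exact funext fun i => Prod.ext (hz.2 i).1 rfl
  · rintro ⟨z, w⟩ _
    simp only [Finset.prod_mul_distrib]
    ring

theorem tupleConv_one (h : (Fin k → ℕ) → R) {n : Fin k → ℕ} (hn : ∀ i, n i ≠ 0) :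
    tupleConv 1 h n = h n := by
  rw [tupleConv, Finset.sum_eq_single fun i => (1, n i)]
  · simp
  · intro z hz hne
    obtain ⟨i, hi⟩ := Function.ne_iff.1 hne
    rw [mem_tupleAntidiag] at hz
    have h1 : (z i).1 ≠ 1 := fun h1 => hi (Prod.ext h1 (by simpa [h1] using (hz i).1))
    rw [Finset.prod_eq_zero (Finset.mem_univ i) (ArithmeticFunction.one_apply_ne h1), zero_mul]
  · intro h1
    exact absurd (mem_tupleAntidiag.2 fun i => ⟨one_mul _, hn i⟩) h1

theorem prodFiberSum_prod_eq_pow (φ : ArithmeticFunction R) (k : ℕ) :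
    prodFiberSum (fun d : Fin k → ℕ => ∏ i, φ (d i)) = φ ^ k := by
  induction k with
  | zero =>
    ext m
    rw [prodFiberSum_apply, pow_zero]
    rcases eq_or_ne m 1 with rfl | hm
    · simp [Nat.finMulAntidiag_one]
    · rw [Nat.finMulAntidiag_zero_left hm, ArithmeticFunction.one_apply_ne hm, Finset.sum_empty]
  | succ k ih =>
    ext m
    rw [pow_succ', ← ih, ArithmeticFunction.mul_apply, prodFiberSum_apply]
    simp only [prodFiberSum_apply, Finset.mul_sum]
    rw [Finset.sum_sigma']
    refine Finset.sum_nbij' (fun d => ⟨(d 0, ∏ i, Fin.tail d i), Fin.tail d⟩)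
      (fun z => Fin.cons z.1.1 z.2) ?_ ?_ ?_ ?_ ?_
    · intro d hd
      have h0 := Nat.ne_zero_of_mem_finMulAntidiag hd
      simp only [Finset.mem_sigma, Nat.mem_finMulAntidiag, Nat.mem_divisorsAntidiagonal] at hd ⊢
      rw [Fin.prod_univ_succ] at hd
      exact ⟨hd, trivial, Finset.prod_ne_zero_iff.2 fun i _ => h0 _⟩
    · rintro ⟨⟨a, b⟩, e⟩ h
      simp only [Finset.mem_sigma, Nat.mem_finMulAntidiag, Nat.mem_divisorsAntidiagonal] at h ⊢
      rw [Fin.prod_univ_succ]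
      simp only [Fin.cons_zero, Fin.cons_succ]
      rw [h.2.1]
      exact h.1
    · intro d _; exact Fin.cons_self_tail d
    · rintro ⟨⟨a, b⟩, e⟩ h
      simp only [Finset.mem_sigma, Nat.mem_finMulAntidiag, Nat.mem_divisorsAntidiagonal] at h
      simp [h.2.1]
    · intro d _
      rw [Fin.prod_univ_succ]; rfl

/-- Both sides sum over pairs of tuples (u, v) with ∏ u_i v_i = m. This is the source of the k-th
power in the Euler factors. -/
theorem prodFiberSum_tupleConv (φ : ArithmeticFunction R) (h : (Fin k → ℕ) → R) :
    prodFiberSum (tupleConv φ h) = φ ^ k * prodFiberSum h := by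
  ext m
  rw [← prodFiberSum_prod_eq_pow, ArithmeticFunction.mul_apply, prodFiberSum_apply]
  simp only [prodFiberSum_apply, Finset.sum_mul_sum, tupleConv]
  simp only [← Finset.sum_product']
  rw [Finset.sum_sigma', Finset.sum_sigma']
  refine Finset.sum_nbij'
    (fun z => ⟨(∏ i, (z.2 i).1, ∏ i, (z.2 i).2), (fun i => (z.2 i).1, fun i => (z.2 i).2)⟩)
    (fun z => ⟨fun i => z.2.1 i * z.2.2 i, fun i => (z.2.1 i, z.2.2 i)⟩) ?_ ?_ ?_ ?_ ?_
  · rintro ⟨d, z⟩ hz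
    simp only [Finset.mem_sigma, Finset.mem_product, Nat.mem_finMulAntidiag,
      Nat.mem_divisorsAntidiagonal, mem_tupleAntidiag] at hz ⊢
    have h1 : (∏ i, (z i).1) * ∏ i, (z i).2 = m := by
      rw [← Finset.prod_mul_distrib, ← hz.1.1]
      exact Finset.prod_congr rfl fun i _ => (hz.2 i).1
    refine ⟨⟨h1, hz.1.2⟩, ⟨trivial, ?_⟩, trivial, ?_⟩
    · exact left_ne_zero_of_mul (h1 ▸ hz.1.2)
    · exact right_ne_zero_of_mul (h1 ▸ hz.1.2)
  · rintro ⟨⟨a, b⟩, ⟨u, v⟩⟩ hz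
    simp only [Finset.mem_sigma, Finset.mem_product, Nat.mem_finMulAntidiag,
      Nat.mem_divisorsAntidiagonal, mem_tupleAntidiag] at hz ⊢
    have h1 : ∏ i, u i * v i = m := by
      rw [Finset.prod_mul_distrib, hz.2.1.1, hz.2.2.1, hz.1.1]
    refine ⟨⟨h1, hz.1.2⟩, fun i => ⟨trivial, ?_⟩⟩
    exact Finset.prod_ne_zero_iff.1 (h1 ▸ hz.1.2) i (Finset.mem_univ i)
  · rintro ⟨d, z⟩ hz
    simp only [Finset.mem_sigma, mem_tupleAntidiag] at hz
    have : d = fun i => (z i).1 * (z i).2 := funext fun i => (hz.2 i).1.symm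
    subst this
    rfl
  · rintro ⟨⟨a, b⟩, ⟨u, v⟩⟩ hz
    simp only [Finset.mem_sigma, Finset.mem_product, Nat.mem_finMulAntidiag] at hz
    obtain ⟨-, ⟨rfl, -⟩, rfl, -⟩ := hz
    rfl
  · rintro ⟨d, z⟩ _
    rfl

end TupleConvolution

/-! ### The kernel of f([n_1,…,n_k]) and its size at prime powers -/

/-- `n ↦ μ(n) n`, the Dirichlet inverse of the identity. -/
def moebiusId : ArithmeticFunction ℂ :=
  ⟨fun n => (ArithmeticFunction.moebius n : ℂ) * n, by simp⟩

/-- `n ↦ n`, with complex values. -/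
def idComplex : ArithmeticFunction ℂ := ⟨fun n => (n : ℂ), by simp⟩

theorem moebiusId_apply (n : ℕ) :
    moebiusId n = (ArithmeticFunction.moebius n : ℂ) * n := rfl

theorem idComplex_apply (n : ℕ) : idComplex n = n := rfl

theorem isMultiplicative_moebiusId : moebiusId.IsMultiplicative := by
  refine ⟨by simp [moebiusId_apply], fun {m n} hmn => ?_⟩
  rw [moebiusId_apply, moebiusId_apply, moebiusId_apply,
    ArithmeticFunction.isMultiplicative_moebius.map_mul_of_coprime hmn]
  push_cast
  ring

theorem idComplex_mul_moebiusId : idComplex * moebiusId = 1 := by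
  ext n
  have h : (idComplex * moebiusId) n =
      n * (((ArithmeticFunction.zeta : ArithmeticFunction ℂ) *
        (ArithmeticFunction.moebius : ArithmeticFunction ℂ)) n) := by
    rw [ArithmeticFunction.mul_apply, ArithmeticFunction.mul_apply, Finset.mul_sum]
    refine Finset.sum_congr rfl fun z hz => ?_
    obtain ⟨h1, h2⟩ := Nat.mem_divisorsAntidiagonal.1 hz
    have h3 : z.1 ≠ 0 := left_ne_zero_of_mul (h1 ▸ h2)
    rw [idComplex_apply, moebiusId_apply, ← h1]
    simp only [ArithmeticFunction.natCoe_apply, ArithmeticFunction.zeta_apply_ne h3,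
      ArithmeticFunction.intCoe_apply]
    push_cast
    ring
  rw [h, ArithmeticFunction.coe_zeta_mul_coe_moebius]
  rcases eq_or_ne n 1 with rfl | hn
  · simp
  · simp [ArithmeticFunction.one_apply_ne hn]

/-- The multiplicative tuple function `g` with `f([n_1, …, n_k]) = ∑_{d_i ∣ n_i} g(d) ∏ n_i / d_i`. -/
def lcmKernel (f : ArithmeticFunction ℂ) (k : ℕ) : (Fin k → ℕ) → ℂ :=
  tupleConv moebiusId fun n => f (Finset.univ.lcm n)

theorem tupleConv_lcmKernel (f : ArithmeticFunction ℂ) {k : ℕ} {n : Fin k → ℕ}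
    (hn : ∀ i, n i ≠ 0) : tupleConv idComplex (lcmKernel f k) n = f (Finset.univ.lcm n) := by
  rw [lcmKernel, tupleConv_tupleConv, idComplex_mul_moebiusId, tupleConv_one _ hn]

theorem isTupleMultiplicative_lcmKernel {f : ArithmeticFunction ℂ} (hf : f.IsMultiplicative)
    (k : ℕ) : IsTupleMultiplicative (lcmKernel f k) :=
  (isTupleMultiplicative_lcm hf).tupleConv isMultiplicative_moebiusId

theorem ClassA.exists_norm_sub_le {f : ArithmeticFunction ℂ} (hf : ClassA 1 f) :
    ∃ C : ℝ, 0 ≤ C ∧ ∀ p : ℕ, p.Prime → ‖f p - p‖ ≤ C * (p : ℝ) ^ (1 / 2 : ℝ) := by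
  obtain ⟨-, ⟨C, hC⟩, -⟩ := hf
  refine ⟨max C 0, le_max_right _ _, fun p hp => ?_⟩
  have h := hC p hp
  rw [Real.rpow_one, show (1 : ℝ) - 1 / 2 = 1 / 2 by norm_num, Complex.ofReal_natCast] at h
  refine h.trans ?_
  gcongr
  exact le_max_left _ _

/-- Extends the bound for ν ≥ 2 to all ν: f(1) = 1, and |f(p)| ≤ p + C₁ p^(1/2) ≤ (C₁ + 1) p. -/
theorem ClassA.exists_norm_prime_pow_le {f : ArithmeticFunction ℂ} (hf : ClassA 1 f) :
    ∃ C : ℝ, 0 ≤ C ∧ ∀ p ν : ℕ, p.Prime → ‖f (p ^ ν)‖ ≤ C * (p : ℝ) ^ ν := by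
  obtain ⟨C₁, hC₁, h₁⟩ := hf.exists_norm_sub_le
  obtain ⟨hm, -, C₂, h₂⟩ := hf
  refine ⟨max C₂ (C₁ + 1), le_max_of_le_right (by positivity), fun p ν hp => ?_⟩
  have hp1 : (1 : ℝ) ≤ p := by exact_mod_cast hp.one_lt.le
  rcases lt_or_ge ν 2 with h | h
  · have h3 : ‖f (p ^ ν)‖ ≤ (C₁ + 1) * (p : ℝ) ^ ν := by
      interval_cases ν
      · simp [hm.map_one, hC₁]
      · rw [pow_one, pow_one]
        have h4 : (p : ℝ) ^ (1 / 2 : ℝ) ≤ p := by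
          simpa using Real.rpow_le_rpow_of_exponent_le hp1 (by norm_num : (1 / 2 : ℝ) ≤ 1)
        have h5 : ‖f p‖ ≤ ‖f p - p‖ + ‖(p : ℂ)‖ := by
          simpa using norm_add_le (f p - p) (p : ℂ)
        rw [Complex.norm_natCast] at h5
        have h6 := h₁ p hp
        nlinarith
    refine h3.trans ?_
    gcongr
    exact le_max_right _ _
  · have h3 := h₂ p ν hp h
    rw [mul_one, Real.rpow_natCast] at h3
    refine h3.trans ?_
    gcongr
    exact le_max_left _ _

theorem lcm_pow_eq_pow_sup {k p : ℕ} (ν : Fin k → ℕ) :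
    (Finset.univ.lcm fun i => p ^ ν i) = p ^ Finset.univ.sup ν := by
  refine Nat.dvd_antisymm
    (Finset.lcm_dvd fun i hi => pow_dvd_pow p (Finset.le_sup (f := ν) hi)) ?_
  rcases isEmpty_or_nonempty (Fin k) with h | h
  · simp
  · obtain ⟨i, hi, hs⟩ := Finset.exists_mem_eq_sup Finset.univ Finset.univ_nonempty ν
    rw [hs]
    exact Finset.dvd_lcm (f := fun i => p ^ ν i) hi

theorem sup_le_sum {k : ℕ} (ν : Fin k → ℕ) : Finset.univ.sup ν ≤ ∑ i, ν i :=
  Finset.sup_le fun _ hi => Finset.single_le_sum (f := ν) (fun _ _ => Nat.zero_le _) hi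

theorem exists_eq_pow_of_dvd_prime_pow {k p N : ℕ} (hp : p.Prime) {d : Fin k → ℕ}
    (hd : ∀ i, d i ∣ p ^ N) : ∃ ν : Fin k → ℕ, d = fun i => p ^ ν i := by
  choose ν hν using fun i => (Nat.dvd_prime_pow hp).1 (hd i)
  exact ⟨ν, funext fun i => (hν i).2⟩

theorem norm_lcm_prime_pow_le {f : ArithmeticFunction ℂ} {C : ℝ} (hC : 0 ≤ C) {p : ℕ}
    (hp : p.Prime) (h : ∀ ν, ‖f (p ^ ν)‖ ≤ C * (p : ℝ) ^ ν) {k N : ℕ} {d : Fin k → ℕ}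
    (hd : ∀ i, d i ∣ p ^ N) : ‖f (Finset.univ.lcm d)‖ ≤ C * ∏ i, (d i : ℝ) := by
  obtain ⟨ν, rfl⟩ := exists_eq_pow_of_dvd_prime_pow hp hd
  have hp1 : (1 : ℝ) ≤ p := by exact_mod_cast hp.one_lt.le
  rw [lcm_pow_eq_pow_sup]
  refine (h _).trans (mul_le_mul_of_nonneg_left ?_ hC)
  push_cast
  rw [Finset.prod_pow_eq_pow_sum]
  exact pow_le_pow_right₀ hp1 (sup_le_sum ν)

theorem norm_moebiusId_le (n : ℕ) : ‖moebiusId n‖ ≤ n := by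
  rw [moebiusId_apply, norm_mul, Complex.norm_natCast]
  have h : ‖(ArithmeticFunction.moebius n : ℂ)‖ ≤ 1 := by
    rw [Complex.norm_intCast]
    exact_mod_cast ArithmeticFunction.abs_moebius_le_one
  nlinarith [Nat.cast_nonneg (α := ℝ) n]

theorem card_divisors_le_of_dvd_prime_pow {p N d : ℕ} (hp : p.Prime) (hd : d ∣ p ^ N) :
    d.divisors.card ≤ N + 1 := by
  refine (Finset.card_le_card
    (Nat.divisors_subset_of_dvd (pow_ne_zero _ hp.ne_zero) hd)).trans ?_
  rw [Nat.divisors_prime_pow hp]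
  simp

theorem card_tupleAntidiag_le {k p N : ℕ} (hp : p.Prime) {d : Fin k → ℕ}
    (hd : ∀ i, d i ∣ p ^ N) : (tupleAntidiag d).card ≤ (N + 1) ^ k := by
  rw [tupleAntidiag, Fintype.card_piFinset]
  refine (Finset.prod_le_pow_card Finset.univ _ (N + 1) fun i _ => ?_).trans (by simp)
  rw [← Nat.map_div_right_divisors, Finset.card_map]
  exact card_divisors_le_of_dvd_prime_pow hp (hd i)

theorem card_finMulAntidiag_prime_pow_le {p : ℕ} (hp : p.Prime) (k N : ℕ) :
    (Nat.finMulAntidiag k (p ^ N)).card ≤ (N + 1) ^ k := by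
  rw [Nat.finMulAntidiag_eq_piFinset_divisors_filter dvd_rfl (pow_ne_zero _ hp.ne_zero)]
  refine (Finset.card_filter_le _ _).trans ?_
  rw [Fintype.card_piFinset]
  refine (Finset.prod_le_pow_card Finset.univ _ (N + 1) fun i _ => ?_).trans (by simp)
  exact card_divisors_le_of_dvd_prime_pow hp dvd_rfl

/-- There are at most (N+1)^k factorisations of d; each term is at most C p^N because |μ(a)a| ≤ a
and, for powers of p, the lcm is at most the product. -/
theorem norm_lcmKernel_le {f : ArithmeticFunction ℂ} {C : ℝ} (hC : 0 ≤ C) {p : ℕ}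
    (hp : p.Prime) (h : ∀ ν, ‖f (p ^ ν)‖ ≤ C * (p : ℝ) ^ ν) {k N : ℕ} {d : Fin k → ℕ}
    (hd : d ∈ Nat.finMulAntidiag k (p ^ N)) :
    ‖lcmKernel f k d‖ ≤ (N + 1) ^ k * (C * (p : ℝ) ^ N) := by
  have hdvd := Nat.dvd_of_mem_finMulAntidiag hd
  have h1 : ∀ z ∈ tupleAntidiag d,
      ‖(∏ i, moebiusId (z i).1) * f (Finset.univ.lcm fun i => (z i).2)‖ ≤ C * (p : ℝ) ^ N := by
    intro z hz
    rw [mem_tupleAntidiag] at hz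
    rw [norm_mul, norm_prod]
    have h2 : ∏ i, ‖moebiusId (z i).1‖ ≤ ∏ i, ((z i).1 : ℝ) :=
      Finset.prod_le_prod (fun _ _ => norm_nonneg _) fun i _ => norm_moebiusId_le _
    have h3 := norm_lcm_prime_pow_le hC hp h (d := fun i => (z i).2) (N := N)
      fun i => (Dvd.intro_left _ (hz i).1).trans (hdvd i)
    refine (mul_le_mul h2 h3 (norm_nonneg _) (by positivity)).trans (le_of_eq ?_)
    rw [mul_left_comm, ← Finset.prod_mul_distrib]
    congr 1
    rw [← Nat.cast_pow, ← Nat.prod_eq_of_mem_finMulAntidiag hd, Nat.cast_prod]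
    refine Finset.prod_congr rfl fun i _ => ?_
    rw [← (hz i).1]; push_cast; rfl
  refine (norm_sum_le _ _).trans ((Finset.sum_le_card_nsmul _ _ _ h1).trans ?_)
  rw [nsmul_eq_mul]
  refine mul_le_mul_of_nonneg_right ?_ (by positivity)
  exact_mod_cast card_tupleAntidiag_le hp hdvd

/-- One coordinate is p and the others are 1, so only two factorisations occur, contributing f(p)
and μ(p) p f(1) = -p. This cancellation is what the hypothesis on f(p) - p exploits. -/
theorem lcmKernel_of_prod_eq_prime {f : ArithmeticFunction ℂ} (hf : f.IsMultiplicative)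
    {k p : ℕ} (hp : p.Prime) {d : Fin k → ℕ} (hd : ∏ i, d i = p) :
    lcmKernel f k d = f p - p := by
  obtain ⟨i, -, hi⟩ := (Nat.Prime.prime hp).exists_mem_finset_dvd (dvd_of_eq hd.symm)
  have hdvd : ∀ j, d j ∣ p := fun j => hd ▸ Finset.dvd_prod_of_mem d (Finset.mem_univ j)
  have hdi : d i = p := Nat.dvd_antisymm (hdvd i) hi
  have hdj : ∀ j, j ≠ i → d j = 1 := by
    intro j hj
    have h1 : d i * ∏ j ∈ Finset.univ.erase i, d j = p := by
      rw [Finset.mul_prod_erase _ _ (Finset.mem_univ i), hd]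
    rw [hdi] at h1
    have h2 := Nat.eq_of_mul_eq_mul_left hp.pos (h1.trans (mul_one p).symm)
    exact Nat.dvd_one.1 (h2 ▸ Finset.dvd_prod_of_mem d (Finset.mem_erase.2 ⟨hj, Finset.mem_univ _⟩))
  have hpair : tupleAntidiag d = {fun j => (1, d j), fun j => (d j, 1)} := by
    ext z
    simp only [mem_tupleAntidiag, Finset.mem_insert, Finset.mem_singleton]
    constructor
    · intro h
      have h1 : ∀ j, j ≠ i → z j = (1, 1) := fun j hj => by
        have := (h j).1
        rw [hdj j hj] at this
        exact Prod.ext (Nat.eq_one_of_mul_eq_one_right this)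
          (Nat.eq_one_of_mul_eq_one_left this)
      have h2 := (h i).1
      rw [hdi] at h2
      rcases (Nat.dvd_prime hp).1 (Dvd.intro _ h2) with h3 | h3
      · refine Or.inl (funext fun j => ?_)
        by_cases hj : j = i
        · subst hj
          exact Prod.ext h3 (by rw [hdi]; simpa [h3] using h2)
        · rw [h1 j hj, hdj j hj]
      · refine Or.inr (funext fun j => ?_)
        by_cases hj : j = i
        · subst hj
          refine Prod.ext (by rw [hdi]; exact h3) ?_
          rw [h3] at h2
          exact Nat.eq_of_mul_eq_mul_left hp.pos (h2.trans (mul_one p).symm)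
        · rw [h1 j hj, hdj j hj]
    · have h0 : ∀ j, d j ≠ 0 := fun j => ne_zero_of_dvd_ne_zero hp.ne_zero (hdvd j)
      rintro (rfl | rfl) j <;> simp [h0]
  have hne : (fun j => (1, d j)) ≠ fun j => (d j, 1) := fun h => by
    have := congrArg Prod.fst (congrFun h i)
    simp only [hdi] at this
    exact hp.one_lt.ne this
  have hlcm : Finset.univ.lcm d = p :=
    Nat.dvd_antisymm (Finset.lcm_dvd fun j _ => hdvd j)
      (hi.trans (Finset.dvd_lcm (Finset.mem_univ i)))
  have hlcm1 : Finset.univ.lcm (fun _ : Fin k => 1) = 1 :=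
    Nat.dvd_one.1 (Finset.lcm_dvd fun _ _ => dvd_rfl)
  have hprod : ∏ j, moebiusId (d j) = -p := by
    rw [Finset.prod_eq_single i (fun j _ hj => by
      rw [hdj j hj, isMultiplicative_moebiusId.map_one]) (by simp), hdi, moebiusId_apply,
      ArithmeticFunction.moebius_apply_prime hp]
    simp
  rw [lcmKernel, tupleConv, hpair, Finset.sum_pair hne]
  simp only [hprod, hlcm1, hf.map_one, isMultiplicative_moebiusId.map_one, Finset.prod_const_one]
  rw [show (Finset.univ.lcm fun i => d i) = p from hlcm]
  ring

/-! ### Absolute convergence of the kernel series for σ > 3/2 -/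

/-- Convergence of a Dirichlet series from the convergence of the sum of its local parts. -/
theorem summable_of_multiplicative_of_local {F : ℕ → ℝ} (h0 : F 0 = 0) (h1 : F 1 = 1)
    (hnn : ∀ n, 0 ≤ F n) (hmul : ∀ {m n : ℕ}, m.Coprime n → F (m * n) = F m * F n)
    {b : ℕ → ℝ} (hb0 : ∀ n, 0 ≤ b n) (hb : Summable b)
    (hs : ∀ {p : ℕ}, p.Prime → Summable fun e => F (p ^ e))
    (hle : ∀ {p : ℕ}, p.Prime → ∑' e, F (p ^ e) ≤ 1 + b p) : Summable F := by
  refine summable_of_sum_le (c := Real.exp (∑' n, b n)) hnn fun u => ?_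
  obtain ⟨N, hN⟩ := u.exists_nat_subset_range
  -- Every positive integer below N is N-smooth, so a finite sum is dominated by a finite Euler
  -- product, and 1 + b ≤ exp b bounds that independently of N.
  have hE := EulerProduct.summable_and_hasSum_smoothNumbers_prod_primesBelow_tsum h1 hmul
    (fun hp => (hs hp).norm) N
  have h2 : ∑ n ∈ u, F n = ∑ n ∈ u.filter (· ∈ N.smoothNumbers), F n := by
    refine (Finset.sum_filter_of_ne fun n hn hFn => ?_).symm
    have hn0 : n ≠ 0 := fun h => hFn (by rw [h, h0])
    exact Nat.mem_smoothNumbers_of_lt (Nat.pos_of_ne_zero hn0) (Finset.mem_range.1 (hN hn))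
  have h3 : ∑ n ∈ u.filter (· ∈ N.smoothNumbers), F n ≤
      ∏ p ∈ N.primesBelow, ∑' e, F (p ^ e) := by
    have h4 : ∑ n ∈ u.filter (· ∈ N.smoothNumbers), F n =
        ∑ n ∈ u.subtype (· ∈ N.smoothNumbers), F n := (Finset.sum_subtype_eq_sum_filter F).symm
    rw [h4]
    exact sum_le_hasSum _ (fun n _ => hnn n) hE.2
  rw [h2]
  refine h3.trans ?_
  calc ∏ p ∈ N.primesBelow, ∑' e, F (p ^ e) ≤ ∏ p ∈ N.primesBelow, Real.exp (b p) := by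
        refine Finset.prod_le_prod (fun p _ => tsum_nonneg fun e => hnn _) fun p hp => ?_
        refine (hle (Nat.prime_of_mem_primesBelow hp)).trans ?_
        rw [add_comm]; exact Real.add_one_le_exp _
    _ = Real.exp (∑ p ∈ N.primesBelow, b p) := (Real.exp_sum _ _).symm
    _ ≤ _ := Real.exp_le_exp.2 (hb.sum_le_tsum _ fun n _ => hb0 n)

theorem summable_add_pow_mul_geometric {r : ℝ} (hr0 : 0 < r) (hr1 : r < 1) (a m : ℕ) :
    Summable fun n : ℕ => ((n : ℝ) + a) ^ m * r ^ n := by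
  have h := summable_pow_mul_geometric_of_norm_lt_one m
    (by rwa [Real.norm_eq_abs, abs_of_pos hr0] : ‖r‖ < 1)
  have h2 := ((summable_nat_add_iff a).2 h).mul_right (r ^ a)⁻¹
  refine h2.congr fun n => ?_
  rw [pow_add]
  push_cast
  field_simp

/-- The exponent 2k combines (N+1)^k tuples d with the factor (N+1)^k in the bound for each. -/
theorem prodFiberSum_norm_prime_pow_le {f : ArithmeticFunction ℂ} {C : ℝ} (hC : 0 ≤ C) {p : ℕ}
    (hp : p.Prime) (h : ∀ ν, ‖f (p ^ ν)‖ ≤ C * (p : ℝ) ^ ν) (k N : ℕ) :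
    prodFiberSum (fun d => ‖lcmKernel f k d‖) (p ^ N) ≤
      C * ((N : ℝ) + 1) ^ (2 * k) * (p : ℝ) ^ N := by
  rw [prodFiberSum_apply]
  refine (Finset.sum_le_card_nsmul _ _ _ fun d hd => norm_lcmKernel_le hC hp h hd).trans ?_
  rw [nsmul_eq_mul]
  have h1 : ((Nat.finMulAntidiag k (p ^ N)).card : ℝ) ≤ ((N : ℝ) + 1) ^ k := by
    exact_mod_cast card_finMulAntidiag_prime_pow_le hp k N
  calc _ ≤ ((N : ℝ) + 1) ^ k * ((N + 1) ^ k * (C * (p : ℝ) ^ N)) := by gcongr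
    _ = _ := by ring

theorem prodFiberSum_norm_prime_le {f : ArithmeticFunction ℂ} (hf : f.IsMultiplicative) {p : ℕ}
    (hp : p.Prime) (k : ℕ) :
    prodFiberSum (fun d => ‖lcmKernel f k d‖) p ≤ 2 ^ k * ‖f p - p‖ := by
  rw [prodFiberSum_apply]
  refine (Finset.sum_le_card_nsmul _ _ ‖f p - p‖ fun d hd => ?_).trans ?_
  · rw [lcmKernel_of_prod_eq_prime hf hp (Nat.prod_eq_of_mem_finMulAntidiag hd)]
  · rw [nsmul_eq_mul]
    refine mul_le_mul_of_nonneg_right ?_ (norm_nonneg _)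
    have := card_finMulAntidiag_prime_pow_le hp k 1
    rw [pow_one] at this
    exact_mod_cast this

theorem prodFiberSum_norm_nonneg (f : ArithmeticFunction ℂ) (k m : ℕ) :
    0 ≤ prodFiberSum (fun d => ‖lcmKernel f k d‖) m :=
  Finset.sum_nonneg fun _ _ => norm_nonneg _

theorem summable_prodFiberSum_norm {f : ArithmeticFunction ℂ} (hf : ClassA 1 f) (k : ℕ) {σ : ℝ}
    (hσ : 3 / 2 < σ) :
    Summable fun m : ℕ => prodFiberSum (fun d => ‖lcmKernel f k d‖) m * (m : ℝ) ^ (-σ) := by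
  obtain ⟨C₁, hC₁, h₁⟩ := hf.exists_norm_sub_le
  obtain ⟨C, hC, h₂⟩ := hf.exists_norm_prime_pow_le
  set P := prodFiberSum (fun d => ‖lcmKernel f k d‖) with hP
  have hPm : P.IsMultiplicative := (isTupleMultiplicative_lcmKernel hf.1 k).norm.prodFiberSum
  have hP0 : ∀ m, 0 ≤ P m := prodFiberSum_norm_nonneg f k
  set r : ℝ := 2 ^ (1 - σ) with hr
  have hr0 : 0 < r := by positivity
  have hr1 : r < 1 := Real.rpow_lt_one_of_one_lt_of_neg (by norm_num) (by linarith)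
  have hS := summable_add_pow_mul_geometric hr0 hr1 3 (2 * k)
  set S := ∑' n : ℕ, ((n : ℝ) + (3 : ℕ)) ^ (2 * k) * r ^ n with hSdef
  have hS0 : 0 ≤ S := tsum_nonneg fun n => by positivity
  -- From p^N with N = n + 2 on, p^(N(1-σ)) = p^(2(1-σ)) (p^(1-σ))^n, and p^(1-σ) ≤ r = 2^(1-σ)
  -- makes the remaining series independent of p. The shift 3 is (n + 2) + 1.
  have key : ∀ {p : ℕ}, p.Prime → ∀ n : ℕ, P (p ^ (n + 2)) * ((p ^ (n + 2) : ℕ) : ℝ) ^ (-σ) ≤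
      C * (p : ℝ) ^ (2 * (1 - σ)) * (((n : ℝ) + (3 : ℕ)) ^ (2 * k) * r ^ n) := by
    intro p hp n
    have hp0 : (0 : ℝ) < p := by exact_mod_cast hp.pos
    have h3 := prodFiberSum_norm_prime_pow_le hC hp (fun ν => h₂ p ν hp) k (n + 2)
    have h4 : (p : ℝ) ^ (n + 2) * ((p ^ (n + 2) : ℕ) : ℝ) ^ (-σ) =
        (p : ℝ) ^ (2 * (1 - σ)) * ((p : ℝ) ^ (1 - σ)) ^ n := by
      push_cast
      rw [← Real.rpow_natCast, ← Real.rpow_natCast, ← Real.rpow_mul hp0.le,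
        ← Real.rpow_mul hp0.le, ← Real.rpow_add hp0, ← Real.rpow_add hp0]
      congr 1
      push_cast
      ring
    have h5 : (p : ℝ) ^ (1 - σ) ≤ r := by
      refine Real.rpow_le_rpow_of_nonpos (by norm_num) ?_ (by linarith)
      exact_mod_cast hp.two_le
    calc P (p ^ (n + 2)) * ((p ^ (n + 2) : ℕ) : ℝ) ^ (-σ)
        ≤ (C * (((n + 2 : ℕ) : ℝ) + 1) ^ (2 * k) * (p : ℝ) ^ (n + 2)) *
          ((p ^ (n + 2) : ℕ) : ℝ) ^ (-σ) := by gcongr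
      _ = C * (((n + 2 : ℕ) : ℝ) + 1) ^ (2 * k) *
          ((p : ℝ) ^ (2 * (1 - σ)) * ((p : ℝ) ^ (1 - σ)) ^ n) := by rw [mul_assoc, h4]
      _ ≤ C * (((n + 2 : ℕ) : ℝ) + 1) ^ (2 * k) * ((p : ℝ) ^ (2 * (1 - σ)) * r ^ n) := by
          gcongr
      _ = _ := by push_cast; ring
  have hsum : ∀ {p : ℕ}, p.Prime →
      Summable fun n : ℕ => P (p ^ (n + 2)) * ((p ^ (n + 2) : ℕ) : ℝ) ^ (-σ) := fun hp =>
    Summable.of_nonneg_of_le (fun n => mul_nonneg (hP0 _) (by positivity)) (key hp)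
      (hS.mul_left _)
  have hsum' : ∀ {p : ℕ}, p.Prime →
      Summable fun n : ℕ => P (p ^ n) * ((p ^ n : ℕ) : ℝ) ^ (-σ) := fun {p} hp =>
    (summable_nat_add_iff (f := fun n : ℕ => P (p ^ n) * ((p ^ n : ℕ) : ℝ) ^ (-σ)) 2).1 (hsum hp)
  -- The two terms of b come from N = 1 and N ≥ 2. Their exponents 1/2 - σ and 2(1 - σ) both fall
  -- below -1 exactly when σ > 3/2.
  refine summable_of_multiplicative_of_local
    (b := fun n => 2 ^ k * C₁ * (n : ℝ) ^ (1 / 2 - σ) + C * S * (n : ℝ) ^ (2 * (1 - σ)))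
    (by simp) (by simp [hPm.map_one]) (fun n => mul_nonneg (hP0 n) (by positivity)) ?_
    (fun n => by positivity) ?_ hsum' ?_
  · intro m n hmn
    rw [hPm.map_mul_of_coprime hmn, Nat.cast_mul, Real.mul_rpow (by positivity) (by positivity)]
    ring
  · exact ((Real.summable_nat_rpow.2 (by linarith)).mul_left _).add
      ((Real.summable_nat_rpow.2 (by linarith)).mul_left _)
  · intro p hp
    have hp0 : (0 : ℝ) < p := by exact_mod_cast hp.pos
    rw [← (hsum' hp).sum_add_tsum_nat_add 2, Finset.sum_range_succ, Finset.sum_range_one]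
    have h3 : P (p ^ 1) * ((p ^ 1 : ℕ) : ℝ) ^ (-σ) ≤ 2 ^ k * C₁ * (p : ℝ) ^ (1 / 2 - σ) := by
      rw [pow_one]
      have h4 : P p ≤ 2 ^ k * (C₁ * (p : ℝ) ^ (1 / 2 : ℝ)) :=
        (prodFiberSum_norm_prime_le hf.1 hp k).trans
          (mul_le_mul_of_nonneg_left (h₁ p hp) (by positivity))
      calc P p * (p : ℝ) ^ (-σ) ≤ 2 ^ k * (C₁ * (p : ℝ) ^ (1 / 2 : ℝ)) * (p : ℝ) ^ (-σ) := by
            gcongr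
        _ = 2 ^ k * C₁ * ((p : ℝ) ^ (1 / 2 : ℝ) * (p : ℝ) ^ (-σ)) := by ring
        _ = _ := by rw [← Real.rpow_add hp0, ← sub_eq_add_neg]
    have h5 : ∑' n : ℕ, P (p ^ (n + 2)) * ((p ^ (n + 2) : ℕ) : ℝ) ^ (-σ) ≤
        C * S * (p : ℝ) ^ (2 * (1 - σ)) := by
      refine ((hsum hp).tsum_le_tsum (key hp) (hS.mul_left _)).trans (le_of_eq ?_)
      rw [tsum_mul_left, ← hSdef]
      ring
    have h6 : P (p ^ 0) * ((p ^ 0 : ℕ) : ℝ) ^ (-σ) = 1 := by simp [hPm.map_one]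
    linarith

/-! ### Local factors and the Euler product for the constant -/

/-- The term at `p^N` of the Dirichlet series of `A` at `2`. -/
def primePowTerm (A : ArithmeticFunction ℂ) (p N : ℕ) : ℂ := A (p ^ N) / (p : ℂ) ^ (2 * N)

theorem primePowTerm_mul (A B : ArithmeticFunction ℂ) {p : ℕ} (hp : p.Prime) (N : ℕ) :
    primePowTerm (A * B) p N =
      ∑ z ∈ Finset.HasAntidiagonal.antidiagonal N, primePowTerm A p z.1 * primePowTerm B p z.2 := by
  have hp0 : (p : ℂ) ≠ 0 := by exact_mod_cast hp.ne_zero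
  rw [primePowTerm, ArithmeticFunction.mul_apply,
    Nat.sum_divisorsAntidiagonal (fun a b => A a * B b), Nat.sum_divisors_prime_pow hp,
    Finset.Nat.sum_antidiagonal_eq_sum_range_succ
      (fun a b => primePowTerm A p a * primePowTerm B p b), Finset.sum_div]
  refine Finset.sum_congr rfl fun i hi => ?_
  have hiN : i ≤ N := Nat.lt_succ_iff.1 (Finset.mem_range.1 hi)
  rw [Nat.pow_div hiN hp.pos, primePowTerm, primePowTerm, div_mul_div_comm, ← pow_add,
    ← mul_add, Nat.add_sub_cancel' hiN]

theorem summable_tsum_primePowTerm_mul {A B : ArithmeticFunction ℂ} {p : ℕ} (hp : p.Prime)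
    (hA : Summable fun N => ‖primePowTerm A p N‖) (hB : Summable fun N => ‖primePowTerm B p N‖) :
    Summable (fun N => ‖primePowTerm (A * B) p N‖) ∧
      ∑' N, primePowTerm (A * B) p N = (∑' N, primePowTerm A p N) * ∑' N, primePowTerm B p N := by
  simp only [primePowTerm_mul A B hp]
  exact ⟨summable_norm_sum_mul_antidiagonal_of_summable_norm hA hB,
    (tsum_mul_tsum_eq_tsum_sum_antidiagonal_of_summable_norm hA hB).symm⟩

/-- Only N = 0 and N = 1 survive; the latter gives -p / p². -/
theorem primePowTerm_moebiusId {p : ℕ} (hp : p.Prime) :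
    Summable (fun N => ‖primePowTerm moebiusId p N‖) ∧
      ∑' N, primePowTerm moebiusId p N = 1 - 1 / (p : ℂ) := by
  have hp0 : (p : ℂ) ≠ 0 := by exact_mod_cast hp.ne_zero
  have h0 : ∀ N ∉ Finset.range 2, primePowTerm moebiusId p N = 0 := by
    intro N hN
    have hN2 : 2 ≤ N := not_lt.1 fun h => hN (Finset.mem_range.2 h)
    rw [primePowTerm, moebiusId_apply,
      ArithmeticFunction.moebius_apply_prime_pow hp (by omega), if_neg (by omega)]
    simp
  constructor
  · exact summable_of_ne_finset_zero (s := Finset.range 2) fun N hN => by rw [h0 N hN, norm_zero]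
  · rw [tsum_eq_sum h0, Finset.sum_range_succ, Finset.sum_range_one]
    simp only [primePowTerm, moebiusId_apply, pow_zero, pow_one,
      ArithmeticFunction.moebius_apply_prime hp]
    simp
    field_simp
    ring

theorem primePowTerm_moebiusId_pow_mul {B : ArithmeticFunction ℂ} {p : ℕ} (hp : p.Prime)
    (hB : Summable fun N => ‖primePowTerm B p N‖) (k : ℕ) :
    Summable (fun N => ‖primePowTerm (moebiusId ^ k * B) p N‖) ∧
      ∑' N, primePowTerm (moebiusId ^ k * B) p N =
        (1 - 1 / (p : ℂ)) ^ k * ∑' N, primePowTerm B p N := by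
  induction k with
  | zero => simpa using hB
  | succ k ih =>
    have h := primePowTerm_moebiusId hp
    have h2 := summable_tsum_primePowTerm_mul hp h.1 ih.1
    rw [← mul_assoc, ← pow_succ'] at h2
    refine ⟨h2.1, ?_⟩
    rw [h2.2, h.2, ih.2, pow_succ']
    ring

theorem sum_antidiagonalTuple_eq {M : Type*} [AddCommMonoid M] {p : ℕ} (hp : p.Prime) (k N : ℕ)
    (F : (Fin k → ℕ) → M) :
    ∑ ν ∈ Finset.Nat.antidiagonalTuple k N, F (fun i => p ^ ν i) =
      ∑ d ∈ Nat.finMulAntidiag k (p ^ N), F d := by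
  refine Finset.sum_bij (fun ν _ i => p ^ ν i) ?_ ?_ ?_ ?_
  · intro ν hν
    rw [Nat.mem_finMulAntidiag, Finset.prod_pow_eq_pow_sum, Finset.Nat.mem_antidiagonalTuple.1 hν]
    exact ⟨rfl, pow_ne_zero _ hp.ne_zero⟩
  · intro ν _ ν' _ h
    exact funext fun i => Nat.pow_right_injective hp.two_le (congrFun h i)
  · intro d hd
    obtain ⟨ν, rfl⟩ := exists_eq_pow_of_dvd_prime_pow hp (Nat.dvd_of_mem_finMulAntidiag hd)
    have h := Nat.prod_eq_of_mem_finMulAntidiag hd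
    rw [Finset.prod_pow_eq_pow_sum] at h
    exact ⟨ν, Finset.Nat.mem_antidiagonalTuple.2 (Nat.pow_right_injective hp.two_le h), rfl⟩
  · intro ν _; rfl

theorem sum_lcmLocalTerm_eq (f : ArithmeticFunction ℂ) {p : ℕ} (hp : p.Prime) (k N : ℕ) :
    ∑ ν ∈ Finset.Nat.antidiagonalTuple k N, lcmLocalTerm f k p ν =
      primePowTerm (prodFiberSum fun n : Fin k → ℕ => f (Finset.univ.lcm n)) p N := by
  rw [primePowTerm, prodFiberSum_apply, ← sum_antidiagonalTuple_eq hp, Finset.sum_div]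
  refine Finset.sum_congr rfl fun ν hν => ?_
  rw [lcmLocalTerm, lcm_pow_eq_pow_sup, Finset.Nat.mem_antidiagonalTuple.1 hν]

theorem norm_lcmLocalTerm_le {f : ArithmeticFunction ℂ} {C : ℝ} (hC : 0 ≤ C) {p : ℕ}
    (hp : p.Prime) (h : ∀ ν, ‖f (p ^ ν)‖ ≤ C * (p : ℝ) ^ ν) {k N : ℕ} {ν : Fin k → ℕ}
    (hν : ∑ i, ν i = N) : ‖lcmLocalTerm f k p ν‖ ≤ C * (1 / 2) ^ N := by
  have hp2 : (2 : ℝ) ≤ p := by exact_mod_cast hp.two_le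
  have hp1 : (1 : ℝ) ≤ p := by linarith
  have hp0 : (0 : ℝ) < p := by linarith
  rw [lcmLocalTerm, norm_div, norm_pow, Complex.norm_natCast, hν, div_le_iff₀ (by positivity)]
  have h1 : (p : ℝ) ^ Finset.univ.sup ν ≤ p ^ N :=
    pow_le_pow_right₀ hp1 (hν ▸ sup_le_sum ν)
  have h2 : (p : ℝ) ^ N ≤ (1 / 2) ^ N * (p : ℝ) ^ (2 * N) := by
    rw [pow_mul, ← mul_pow]
    exact pow_le_pow_left₀ hp0.le (by nlinarith) N
  calc _ ≤ C * (p : ℝ) ^ Finset.univ.sup ν := h _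
    _ ≤ C * ((1 / 2) ^ N * (p : ℝ) ^ (2 * N)) :=
        mul_le_mul_of_nonneg_left (h1.trans h2) hC
    _ = _ := by ring

theorem card_antidiagonalTuple_le (k N : ℕ) :
    (Finset.Nat.antidiagonalTuple k N).card ≤ (N + 1) ^ k := by
  have h : Finset.Nat.antidiagonalTuple k N ⊆
      Fintype.piFinset fun _ : Fin k => Finset.range (N + 1) := by
    intro ν hν
    rw [Fintype.mem_piFinset]
    intro i
    rw [Finset.mem_range, Nat.lt_succ_iff, ← Finset.Nat.mem_antidiagonalTuple.1 hν]
    exact Finset.single_le_sum (f := ν) (fun _ _ => Nat.zero_le _) (Finset.mem_univ i)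
  refine (Finset.card_le_card h).trans ?_
  simp

/-- Grouping exponent vectors by their sum N, each of the at most (N+1)^k terms is O(2^(-N)), since
max ν_i ≤ N leaves at most p^(N-2N). The grouping also identifies the k-fold series with a
one-variable local series. -/
theorem lcmLocalTerm_summable_tsum {f : ArithmeticFunction ℂ} (hf : ClassA 1 f) (k : ℕ) {p : ℕ}
    (hp : p.Prime) :
    Summable (lcmLocalTerm f k p) ∧
      Summable (fun N => ‖primePowTerm
        (prodFiberSum fun n : Fin k → ℕ => f (Finset.univ.lcm n)) p N‖) ∧
      ∑' ν, lcmLocalTerm f k p ν =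
        ∑' N, primePowTerm (prodFiberSum fun n : Fin k → ℕ => f (Finset.univ.lcm n)) p N := by
  obtain ⟨C, hC, h⟩ := hf.exists_norm_prime_pow_le
  set T := lcmLocalTerm f k p with hT
  set e := Finset.Nat.sigmaAntidiagonalTupleEquivTuple k with he
  have hb : Summable fun N : ℕ => ((N : ℝ) + (1 : ℕ)) ^ k * (1 / 2) ^ N :=
    summable_add_pow_mul_geometric (by norm_num) (by norm_num) 1 k
  have hfib : ∀ N, ∑ ν ∈ Finset.Nat.antidiagonalTuple k N, ‖T ν‖ ≤
      C * (((N : ℝ) + (1 : ℕ)) ^ k * (1 / 2) ^ N) := by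
    intro N
    refine (Finset.sum_le_card_nsmul _ _ (C * (1 / 2) ^ N) fun ν hν =>
      norm_lcmLocalTerm_le hC hp (fun ν => h p ν hp)
        (Finset.Nat.mem_antidiagonalTuple.1 hν)).trans ?_
    rw [nsmul_eq_mul]
    have h1 : ((Finset.Nat.antidiagonalTuple k N).card : ℝ) ≤ ((N : ℝ) + (1 : ℕ)) ^ k := by
      exact_mod_cast card_antidiagonalTuple_le k N
    calc _ ≤ ((N : ℝ) + (1 : ℕ)) ^ k * (C * (1 / 2) ^ N) := by gcongr
      _ = _ := by ring
  have hsig : Summable fun z : Σ N, Finset.Nat.antidiagonalTuple k N => ‖T (e z)‖ := by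
    rw [summable_sigma_of_nonneg fun _ => norm_nonneg _]
    refine ⟨fun N => Summable.of_finite, ?_⟩
    refine Summable.of_nonneg_of_le (fun N => tsum_nonneg fun _ => norm_nonneg _) (fun N => ?_)
      (hb.mul_left C)
    rw [tsum_fintype]
    refine le_trans (le_of_eq ?_) (hfib N)
    exact Finset.sum_coe_sort (Finset.Nat.antidiagonalTuple k N) fun ν => ‖T ν‖
  have hsum : Summable T := (e.summable_iff (f := T)).1 hsig.of_norm
  refine ⟨hsum, ?_, ?_⟩
  · refine Summable.of_nonneg_of_le (fun _ => norm_nonneg _) (fun N => ?_) (hb.mul_left C)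
    rw [← sum_lcmLocalTerm_eq f hp]
    exact (norm_sum_le _ _).trans (hfib N)
  · rw [← e.tsum_eq T, hsig.of_norm.tsum_sigma' fun N => Summable.of_finite]
    refine tsum_congr fun N => ?_
    rw [tsum_fintype, ← sum_lcmLocalTerm_eq f hp]
    exact Finset.sum_coe_sort (Finset.Nat.antidiagonalTuple k N) fun ν => T ν

theorem lcmLocalFactor_eq {f : ArithmeticFunction ℂ} (hf : ClassA 1 f) (k : ℕ) {p : ℕ}
    (hp : p.Prime) :
    lcmLocalFactor f k p = ∑' N, primePowTerm (prodFiberSum (lcmKernel f k)) p N := by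
  obtain ⟨-, h1, h2⟩ := lcmLocalTerm_summable_tsum hf k hp
  rw [lcmLocalFactor, h2, lcmKernel, prodFiberSum_tupleConv,
    (primePowTerm_moebiusId_pow_mul hp h1 k).2]

theorem norm_prodFiberSum_le (f : ArithmeticFunction ℂ) (k m : ℕ) :
    ‖prodFiberSum (lcmKernel f k) m‖ ≤ prodFiberSum (fun d => ‖lcmKernel f k d‖) m :=
  norm_sum_le _ _

theorem summable_norm_prodFiberSum_div_sq {f : ArithmeticFunction ℂ} (hf : ClassA 1 f) (k : ℕ) :
    Summable fun m : ℕ => ‖prodFiberSum (lcmKernel f k) m / (m : ℂ) ^ 2‖ := by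
  refine Summable.of_nonneg_of_le (fun _ => norm_nonneg _) (fun m => ?_)
    (summable_prodFiberSum_norm hf k (σ := 2) (by norm_num))
  rw [norm_div, norm_pow, Complex.norm_natCast, div_eq_mul_inv, Real.rpow_neg (by positivity),
    Real.rpow_two]
  exact mul_le_mul_of_nonneg_right (norm_prodFiberSum_le f k m) (by positivity)

theorem hasProd_lcmLocalFactor {f : ArithmeticFunction ℂ} (hf : ClassA 1 f) (k : ℕ) :
    HasProd (fun p : Nat.Primes => lcmLocalFactor f k p)
      (∑' m : ℕ, prodFiberSum (lcmKernel f k) m / (m : ℂ) ^ 2) := by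
  have hm := (isTupleMultiplicative_lcmKernel hf.1 k).prodFiberSum
  have h := EulerProduct.eulerProduct_hasProd
    (f := fun m : ℕ => prodFiberSum (lcmKernel f k) m / (m : ℂ) ^ 2)
    (by simp [hm.map_one])
    (fun {m n} hmn => by
      rw [hm.map_mul_of_coprime hmn, Nat.cast_mul, mul_pow, div_mul_div_comm])
    (summable_norm_prodFiberSum_div_sq hf k) (by simp)
  convert h using 2 with p
  rw [lcmLocalFactor_eq hf k p.2]
  refine tsum_congr fun N => ?_
  rw [primePowTerm, Nat.cast_pow, ← pow_mul, mul_comm N]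

theorem lcmConst_eq {f : ArithmeticFunction ℂ} (hf : ClassA 1 f) (k : ℕ) :
    lcmConst f k = ∑' m : ℕ, prodFiberSum (lcmKernel f k) m / (m : ℂ) ^ 2 :=
  (hasProd_lcmLocalFactor hf k).tprod_eq

/-! ### Summation over d and the asymptotic formula -/

theorem mul_mem_ballPoints {k : ℕ} {d e : Fin k → ℕ} (hd : ∀ i, 1 ≤ d i) {x : ℝ}
    (he : e ∈ ellipsoidPoints k d x) : (fun i => d i * e i) ∈ ballPoints k x := by
  rw [mem_ellipsoidPoints hd] at he
  rw [mem_ballPoints]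
  refine ⟨fun i => Nat.mul_pos (hd i) (he.1 i), ?_⟩
  push_cast
  exact he.2

theorem prod_le_of_mem_ellipsoidPoints {k : ℕ} {d e : Fin k → ℕ} (hd : ∀ i, 1 ≤ d i) {x : ℝ}
    (he : e ∈ ellipsoidPoints k d x) : ∏ i, d i ≤ ⌊x⌋₊ ^ k := by
  have h1 := mul_mem_ballPoints hd he
  rw [mem_ellipsoidPoints hd] at he
  simp only [ballPoints, Finset.mem_filter, Fintype.mem_piFinset, Finset.mem_Icc] at h1
  refine (Finset.prod_le_pow_card Finset.univ _ ⌊x⌋₊ fun i _ => ?_).trans (by simp)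
  exact (Nat.le_mul_of_pos_right _ (he.1 i)).trans (h1.1 i).2

theorem lcmBallSum_eq (f : ArithmeticFunction ℂ) (k : ℕ) (x : ℝ) :
    lcmBallSum f k x = ∑ m ∈ Finset.range (⌊x⌋₊ ^ k + 1), ∑ d ∈ Nat.finMulAntidiag k m,
      lcmKernel f k d * ellipsoidSum k d x := by
  have h1 : lcmBallSum f k x = ∑ n ∈ ballPoints k x, tupleConv idComplex (lcmKernel f k) n := by
    refine Finset.sum_congr rfl fun n hn => ?_
    rw [mem_ballPoints] at hn
    exact (tupleConv_lcmKernel f fun i => Nat.one_le_iff_ne_zero.1 (hn.1 i)).symm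
  rw [h1]
  simp only [tupleConv, ellipsoidSum]
  push_cast
  simp only [Finset.mul_sum]
  simp only [Finset.sum_sigma']
  refine Finset.sum_nbij'
    (fun z => ⟨∏ i, (z.2 i).2, ⟨fun i => (z.2 i).2, fun i => (z.2 i).1⟩⟩)
    (fun z => ⟨fun i => z.2.1 i * z.2.2 i, fun i => (z.2.2 i, z.2.1 i)⟩) ?_ ?_ ?_ ?_ ?_
  · rintro ⟨n, z⟩ hz
    simp only [Finset.mem_sigma, mem_tupleAntidiag, mem_ballPoints] at hz
    obtain ⟨⟨-, hx⟩, hz⟩ := hz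
    have hz1 : ∀ i, 1 ≤ (z i).1 := fun i =>
      Nat.one_le_iff_ne_zero.2 (left_ne_zero_of_mul ((hz i).1 ▸ (hz i).2))
    have hz2 : ∀ i, 1 ≤ (z i).2 := fun i =>
      Nat.one_le_iff_ne_zero.2 (right_ne_zero_of_mul ((hz i).1 ▸ (hz i).2))
    have he : (fun i => (z i).1) ∈ ellipsoidPoints k (fun i => (z i).2) x := by
      rw [mem_ellipsoidPoints hz2]
      refine ⟨hz1, le_trans (le_of_eq (Finset.sum_congr rfl fun i _ => ?_)) hx⟩
      rw [← (hz i).1]; push_cast; ring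
    simp only [Finset.mem_sigma, Nat.mem_finMulAntidiag, Finset.mem_range]
    exact ⟨Nat.lt_succ_of_le (prod_le_of_mem_ellipsoidPoints hz2 he),
      ⟨trivial, Finset.prod_ne_zero_iff.2 fun i _ => Nat.one_le_iff_ne_zero.1 (hz2 i)⟩, he⟩
  · rintro ⟨m, ⟨d, e⟩⟩ h
    simp only [Finset.mem_sigma] at h
    have hd : ∀ i, 1 ≤ d i := fun i =>
      Nat.one_le_iff_ne_zero.2 (Nat.ne_zero_of_mem_finMulAntidiag h.2.1 i)
    have he := ((mem_ellipsoidPoints hd).1 h.2.2).1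
    simp only [Finset.mem_sigma, mem_tupleAntidiag]
    refine ⟨mul_mem_ballPoints hd h.2.2, fun i => ⟨mul_comm _ _, ?_⟩⟩
    exact (Nat.mul_pos (hd i) (he i)).ne'
  · rintro ⟨n, z⟩ hz
    simp only [Finset.mem_sigma, mem_tupleAntidiag] at hz
    have : n = fun i => (z i).2 * (z i).1 := funext fun i => by rw [← (hz.2 i).1, mul_comm]
    subst this
    rfl
  · rintro ⟨m, ⟨d, e⟩⟩ h
    simp only [Finset.mem_sigma, Nat.mem_finMulAntidiag] at h
    obtain ⟨-, ⟨rfl, -⟩, -⟩ := h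
    rfl
  · rintro ⟨n, z⟩ _
    simp only [idComplex_apply]
    ring

/-- For m > ⌊x⌋^k the ellipsoids are empty. As a series over all m, the sum can be compared termwise
with the series for the constant, so no tail is estimated separately. -/
theorem hasSum_lcmBallSum (f : ArithmeticFunction ℂ) (k : ℕ) (x : ℝ) :
    HasSum (fun m : ℕ => ∑ d ∈ Nat.finMulAntidiag k m, lcmKernel f k d * ellipsoidSum k d x)
      (lcmBallSum f k x) := by
  rw [lcmBallSum_eq]
  refine hasSum_sum_of_ne_finset_zero fun m hm => Finset.sum_eq_zero fun d hd => ?_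
  have hd1 : ∀ i, 1 ≤ d i := fun i =>
    Nat.one_le_iff_ne_zero.2 (Nat.ne_zero_of_mem_finMulAntidiag hd i)
  have h0 : ellipsoidPoints k d x = ∅ := by
    refine Finset.eq_empty_of_forall_notMem fun e he => hm ?_
    rw [Finset.mem_range, Nat.lt_succ_iff, ← Nat.prod_eq_of_mem_finMulAntidiag hd]
    exact prod_le_of_mem_ellipsoidPoints hd1 he
  simp [ellipsoidSum, h0]

theorem exists_norm_lcmBallSum_sub_le {f : ArithmeticFunction ℂ} (hf : ClassA 1 f) {k : ℕ}
    (hk : 1 ≤ k) {θ : ℝ} (hθ0 : 0 ≤ θ) (hθ : θ < 1 / 2) : ∃ K : ℝ, 0 ≤ K ∧ ∀ x : ℝ, 1 ≤ x →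
      ‖lcmBallSum f k x - lcmConst f k / ((2 : ℂ) ^ k * (k.factorial : ℂ)) * (x : ℂ) ^ k‖
        ≤ K * x ^ ((k : ℝ) - θ / 2) := by
  obtain ⟨C, hC, h⟩ := exists_abs_ellipsoidSum_sub_le_rpow k hk
  -- The interpolated error carries D^(θ-2), so convergence is needed at σ = 2 - θ, which exceeds
  -- 3/2 precisely when θ < 1/2.
  have hS := summable_prodFiberSum_norm hf k (σ := 2 - θ) (by linarith)
  set S := ∑' m : ℕ, prodFiberSum (fun d => ‖lcmKernel f k d‖) m * (m : ℝ) ^ (-(2 - θ)) with hSdef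
  have hS0 : 0 ≤ S := tsum_nonneg fun m =>
    mul_nonneg (prodFiberSum_norm_nonneg f k m) (by positivity)
  refine ⟨C * S, by positivity, fun x hx => ?_⟩
  have hx0 : 0 < x := by linarith
  have h1 := hasSum_lcmBallSum f k x
  have h2 : HasSum (fun m : ℕ => prodFiberSum (lcmKernel f k) m / (m : ℂ) ^ 2 *
      ((x : ℂ) ^ k / ((2 : ℂ) ^ k * (k.factorial : ℂ))))
      (lcmConst f k * ((x : ℂ) ^ k / ((2 : ℂ) ^ k * (k.factorial : ℂ)))) := by
    rw [lcmConst_eq hf k]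
    exact (summable_norm_prodFiberSum_div_sq hf k).of_norm.hasSum.mul_right _
  have h3 := h1.sub h2
  have h4 : lcmBallSum f k x - lcmConst f k / ((2 : ℂ) ^ k * (k.factorial : ℂ)) * (x : ℂ) ^ k =
      lcmBallSum f k x - lcmConst f k * ((x : ℂ) ^ k / ((2 : ℂ) ^ k * (k.factorial : ℂ))) := by
    ring
  rw [h4, ← h3.tsum_eq]
  have h5 : HasSum (fun m : ℕ => C * x ^ ((k : ℝ) - θ / 2) *
      (prodFiberSum (fun d => ‖lcmKernel f k d‖) m * (m : ℝ) ^ (-(2 - θ))))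
      (C * x ^ ((k : ℝ) - θ / 2) * S) := hS.hasSum.mul_left _
  refine (tsum_of_norm_bounded h5 fun m => ?_).trans (le_of_eq (by ring))
  rw [prodFiberSum_apply, prodFiberSum_apply, Finset.sum_div, Finset.sum_mul,
    ← Finset.sum_sub_distrib, Finset.sum_mul, Finset.mul_sum]
  refine (norm_sum_le _ _).trans (Finset.sum_le_sum fun d hd => ?_)
  have hd1 : ∀ i, 1 ≤ d i := fun i =>
    Nat.one_le_iff_ne_zero.2 (Nat.ne_zero_of_mem_finMulAntidiag hd i)
  have h6 := h d hd1 x hx θ hθ0 (by linarith)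
  rw [Nat.prod_eq_of_mem_finMulAntidiag hd] at h6
  have h7 : lcmKernel f k d * (ellipsoidSum k d x : ℂ) - lcmKernel f k d / (m : ℂ) ^ 2 *
      ((x : ℂ) ^ k / ((2 : ℂ) ^ k * (k.factorial : ℂ))) =
      lcmKernel f k d * ((ellipsoidSum k d x -
        x ^ k / (2 ^ k * (k.factorial : ℝ) * (m : ℝ) ^ 2) : ℝ) : ℂ) := by
    push_cast
    rw [mul_sub, div_mul_div_comm, mul_div_assoc, mul_comm ((m : ℂ) ^ 2)]
  rw [h7, norm_mul, Complex.norm_real, Real.norm_eq_abs]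
  refine (mul_le_mul_of_nonneg_left h6 (norm_nonneg _)).trans (le_of_eq ?_)
  rw [neg_sub]
  ring

end

theorem mainTheorem2 (k : ℕ) (hk : 2 ≤ k) (f : ArithmeticFunction ℂ) (hf : ClassA 1 f) :
    (∀ p : Nat.Primes, Summable (lcmLocalTerm f k p)) ∧
    Multipliable (fun p : Nat.Primes => lcmLocalFactor f k p) ∧
    ∀ ε : ℝ, 0 < ε → ∃ K : ℝ, ∀ x : ℝ, 1 ≤ x →
      ‖lcmBallSum f k x - lcmConst f k / ((2 : ℂ) ^ k * (k.factorial : ℂ)) * (x : ℂ) ^ k‖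
        ≤ K * x ^ ((k : ℝ) - 1 / 4 + ε) := by
  refine ⟨fun p => (lcmLocalTerm_summable_tsum hf k p.2).1,
    (hasProd_lcmLocalFactor hf k).multipliable, fun ε hε => ?_⟩
  have hδ0 : 0 < min ε (1 / 4) := lt_min hε (by norm_num)
  have hδ1 : min ε (1 / 4) ≤ 1 / 4 := min_le_right _ _
  -- This θ makes k - θ/2 equal to k - 1/4 + min(ε, 1/4); capping ε at 1/4 keeps θ ≥ 0.
  obtain ⟨K, hK, h⟩ := exists_norm_lcmBallSum_sub_le hf (by omega : 1 ≤ k)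
    (θ := 1 / 2 - 2 * min ε (1 / 4)) (by linarith) (by linarith)
  refine ⟨K, fun x hx => (h x hx).trans ?_⟩
  refine mul_le_mul_of_nonneg_left (Real.rpow_le_rpow_of_exponent_le hx ?_) hK
  linarith [min_le_left ε (1 / 4)]
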